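/- Let $n\ge 3$ be an integer and let $b,c,p,\gamma$ be real numbers with $2-n<b<2$, $\;b-2<c<\frac{nbp}{4}$, $\;2(2-b)<np-2c<(2-b)(p+2)$, $\;p<\frac4n$ and $\gamma>-n$ (these conditions force $p>0$). Put $$s_c=\frac n2-\frac{2-b+c}{p},\qquad \sigma_0=\frac{(n+\gamma)p}{2-b+c},\qquad \|f\|_{a,q}=\Big(\int_{\mathbb R^n}|x|^a|f(x)|^q\,dx\Big)^{1/q},$$ and for measurable $u:\mathbb R^n\to\mathbb C$ and $R>0$ let $$\rho(u,R)=\sup_{R'\ge R}\frac1{(R')^{2s_c}}\int_{R'\le|x|\le 2R'}|u|^2\,dx\in[0,\infty].$$ Let $\dot H^{s_c}=(-\Delta)^{-s_c/2}L^2(\mathbb R^n)$, and let $\dot W^{1,2}_b$ be the space of locally integrable $u$ whose weak gradient is a locally integrable function with $\|\nabla u\|_{b,2}<\infty$. (i) Suppose in addition that $\sigma_0\ge 2$ (equivalently $\gamma\ge-2s_c$). There is a constant $C>0$, depending only on $n,b,c,p,\gamma$, such that for all $u\in L^{\sigma_0}(|x|^\gamma dx)$ $$\frac1{R^{2s_c}}\int_{|x|\le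 R}|u|^2\,dx\le C\,\|u\|_{\gamma,\sigma_0}^2\qquad\text{for all }R>0,$$ and, for every such $u$, $$\lim_{R\to+\infty}\frac1{R^{2s_c}}\int_{|x|\le R}|u|^2\,dx=0 .$$ (ii) For every $\eta>0$ there is a constant $C_\eta>0$, depending only on $\eta,n,b,c,p$, such that for all $u\in\dot H^{s_c}\cap\dot W^{1,2}_b$ (not necessarily radial) and all $R>0$ $$\int_{|x|\ge R}|x|^c|u|^{p+2}\,dx\le\eta\,\|\nabla u\|_{b,2}^2+\frac{C_\eta}{R^{\,2-b-2s_c}}\,\rho(u,R)^{\frac{4-np+2p}{4-np}} .$$ -/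

import Mathlib

open MeasureTheory Filter Topology
open scoped ENNReal NNReal FourierTransform SchwartzMap ContDiff

namespace DINLS

/-- The Euclidean space `ℝⁿ` (with its Euclidean norm and Lebesgue measure `volume`). -/
abbrev Rn (n : ℕ) : Type := EuclideanSpace ℝ (Fin n)

/-- The quantity `𝐩_c = n p - 2 c`. -/
noncomputable def pCrit (n : ℕ) (c p : ℝ) : ℝ := n * p - 2 * c

/-- The critical Sobolev index `s_c = n / 2 - (2 - b + c) / p`. -/
noncomputable def sCrit (n : ℕ) (b c p : ℝ) : ℝ := n / 2 - (2 - b + c) / p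

/-- The exponent `σ₀ = (n + γ) p / (2 - b + c)`. -/
noncomputable def sigmaZero (n : ℕ) (b c p γ : ℝ) : ℝ := (n + γ) * p / (2 - b + c)

/-- The weighted Lebesgue norm `‖u‖_{a,q} = (∫ |x|^a |u|^q dx)^{1/q}`, with values in `[0, ∞]`,
for scalar or vector valued `u`. -/
noncomputable def weightedNorm {n : ℕ} {F : Type*} [NormedAddCommGroup F]
    (a q : ℝ) (u : Rn n → F) : ℝ≥0∞ :=
  (∫⁻ x, ENNReal.ofReal (‖x‖ ^ a) * ‖u x‖ₑ ^ q) ^ (1 / q)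

/-- `u` belongs to the weighted Lebesgue space `L^q(|x|^a dx)`. -/
def MemWeightedLp {n : ℕ} {F : Type*} [NormedAddCommGroup F]
    (a q : ℝ) (u : Rn n → F) : Prop :=
  AEStronglyMeasurable u volume ∧ weightedNorm a q u < ⊤

/-- `g = (∂₁u, …, ∂ₙu)` is the weak (distributional) gradient of `u` on `ℝⁿ`. -/
structure IsWeakGradient {n : ℕ} (u : Rn n → ℂ) (g : Rn n → EuclideanSpace ℂ (Fin n)) :
    Prop where
  locallyIntegrable : LocallyIntegrable u volume
  locallyIntegrable_grad : LocallyIntegrable g volume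
  integral_eq : ∀ φ : Rn n → ℝ, ContDiff ℝ ∞ φ → HasCompactSupport φ → ∀ i : Fin n,
    ∫ x, fderiv ℝ φ x (EuclideanSpace.single i 1) • u x = - ∫ x, φ x • g x i

/-- `u ∈ Ẇ_b^{1,2}`, with gradient `g = ∇u`: the weak gradient of `u` is a function, and
`‖∇u‖_{b,2} = (∫ |x|^b |∇u|² dx)^{1/2}` is finite. -/
def MemWeightedSobolev {n : ℕ} (b : ℝ) (u : Rn n → ℂ)
    (g : Rn n → EuclideanSpace ℂ (Fin n)) : Prop :=
  IsWeakGradient u g ∧ MemWeightedLp b 2 g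

/-- `u ∈ Ḣ^s = (-Δ)^{-s/2} L²` (for `0 ≤ s < n / 2`): the Fourier transform of `u`, as a tempered
distribution, is the function `(2π|ξ|)^{-s} h(ξ)` for some `h ∈ L²`
(so that `u = (-Δ)^{-s/2} f`, where `f ∈ L²` has Fourier transform `h`). The identity
`û = (2π|ξ|)^{-s} h` is tested on all Schwartz functions `φ`, as `⟨u, 𝓕 φ⟩ = ⟨(2π|ξ|)^{-s} h, φ⟩`. -/
def MemHomogeneousSobolev {n : ℕ} (s : ℝ) (u : Rn n → ℂ) : Prop :=
  LocallyIntegrable u volume ∧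
  ∃ h : Rn n → ℂ, MemLp h 2 volume ∧
    ∀ φ : 𝓢(Rn n, ℂ),
      Integrable (fun x => u x * 𝓕 (φ : Rn n → ℂ) x) volume ∧
      Integrable (fun ξ => (((2 * Real.pi * ‖ξ‖) ^ (-s) : ℝ) : ℂ) * h ξ * φ ξ) volume ∧
      ∫ x, u x * 𝓕 (φ : Rn n → ℂ) x =
        ∫ ξ, (((2 * Real.pi * ‖ξ‖) ^ (-s) : ℝ) : ℂ) * h ξ * φ ξ

/-- The scaled mass `R^{-2s} ∫_{|x| ≤ R} |u|² dx` of the ball of radius `R > 0`. -/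
noncomputable def ballMass {n : ℕ} (s : ℝ) (u : Rn n → ℂ) (R : ℝ) : ℝ≥0∞ :=
  (∫⁻ x in {x : Rn n | ‖x‖ ≤ R}, ‖u x‖ₑ ^ 2) / ENNReal.ofReal (R ^ (2 * s))

/-- The Morrey-Campanato type functional
`ρ(u, R) = sup_{R' ≥ R} (R')^{-2s} ∫_{R' ≤ |x| ≤ 2R'} |u|² dx`, with values in `[0, ∞]`. -/
noncomputable def rho {n : ℕ} (s : ℝ) (u : Rn n → ℂ) (R : ℝ) : ℝ≥0∞ :=
  ⨆ (R' : ℝ) (_ : R ≤ R'),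
    (∫⁻ x in {x : Rn n | R' ≤ ‖x‖ ∧ ‖x‖ ≤ 2 * R'}, ‖u x‖ₑ ^ 2) /
      ENNReal.ofReal (R' ^ (2 * s))

end DINLS

/-! The scaling identity `s_c p = np/2 - (2 - b + c)` makes every power of `R` come out right, and
the two bounds on `np - 2c` say exactly that `0 < s_c` and `2 s_c < 2 - b`.

For (i), `(n + γ)/σ₀ = n/2 - s_c`, so Hölder on the ball of radius `R` against a power of `|x|`
yields precisely `R^{2 s_c}` (`exists_ballMass_le`). For the limit, cut `u` at radius `k`: the tail
has small norm, hence uniformly small scaled mass, and the inner mass is a fixed finite number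
divided by `R^{2 s_c} → ∞`.

For (ii), the core is a Sobolev inequality on `{|x| ≥ R}` with weight `|x|^{b/2}` and no boundary
term. It is the Gagliardo–Nirenberg–Sobolev inequality for a cut-off of `|x|^{b/2} u`; the terms
where the derivative hits the weight or the cut-off are of size `|x|^{b/2-1} |u|` and are absorbed
by a Hardy inequality. Hardy itself (`exists_hardy_outer`) compares `v(x)` with `v(2x)`: the
difference is controlled by the gradient, and since `n + b - 2 > 0` the dilation `v ↦ v(2·)`
strictly contracts the weighted `L²` norm on an exterior domain, which it maps into itself. The
absorption needs the Hardy integral to be finite. If `ρ(u, R) < ∞`, this follows by summing over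
dyadic annuli, because `b - 2 + 2 s_c < 0`; if `ρ(u, R) = ∞`, there is nothing to prove.
Mollification and Fatou's lemma pass from `C¹` to weakly differentiable functions
(`exists_weak_sobolev_outer`).

On each dyadic annulus, `L^{p+2}` is interpolated between this Sobolev norm and the `L²` mass
measured by `ρ`. The leftover power of the radius is negative, so the annuli sum geometrically. The
gradient integral appears to the power `np/4 < 1`, and Young's inequality gives the small constant
`η`. -/

namespace DINLS

/-! ### Power weights -/

section PowerWeight

variable {n : ℕ}

/-- The weight `|x|^a`, with values in `[0, ∞]`. -/
noncomputable def normWeight (a : ℝ) (x : Rn n) : ℝ≥0∞ := ENNReal.ofReal (‖x‖ ^ a)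

/-- The exterior region `{|x| ≥ r}`. -/
def outer (n : ℕ) (r : ℝ) : Set (Rn n) := {x | r ≤ ‖x‖}

lemma measurableSet_outer (r : ℝ) : MeasurableSet (outer n r) :=
  measurableSet_le measurable_const measurable_norm

lemma outer_subset {r s : ℝ} (h : r ≤ s) : outer n s ⊆ outer n r := fun _ hx => h.trans hx

lemma ne_zero_of_mem_outer {r : ℝ} (hr : 0 < r) {x : Rn n} (hx : x ∈ outer n r) : x ≠ 0 :=
  norm_pos_iff.mp (hr.trans_le hx)

@[fun_prop]
lemma measurable_normWeight (a : ℝ) : Measurable (normWeight a : Rn n → ℝ≥0∞) :=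
  (measurable_norm.pow_const a).ennreal_ofReal

lemma normWeight_ne_top (a : ℝ) (x : Rn n) : normWeight a x ≠ ⊤ := ENNReal.ofReal_ne_top

lemma normWeight_mul (a b : ℝ) {x : Rn n} (hx : x ≠ 0) :
    normWeight a x * normWeight b x = normWeight (a + b) x := by
  rw [normWeight, normWeight, normWeight, ← ENNReal.ofReal_mul (by positivity),
    Real.rpow_add (norm_pos_iff.mpr hx)]

lemma normWeight_rpow (a : ℝ) {t : ℝ} (ht : 0 ≤ t) (x : Rn n) :
    normWeight a x ^ t = normWeight (a * t) x := by
  rw [normWeight, normWeight, ENNReal.ofReal_rpow_of_nonneg (by positivity) ht,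
    Real.rpow_mul (norm_nonneg _)]

lemma normWeight_zero (x : Rn n) : normWeight 0 x = 1 := by simp [normWeight]

lemma normWeight_smul (a : ℝ) {t : ℝ} (ht : 0 < t) (x : Rn n) :
    normWeight a (t • x) = ENNReal.ofReal (t ^ a) * normWeight a x := by
  rw [normWeight, normWeight, ← ENNReal.ofReal_mul (by positivity), norm_smul,
    Real.norm_of_nonneg ht.le, Real.mul_rpow ht.le (norm_nonneg _)]

/-- Power functions are comparable at comparable points. -/
lemma rpow_le_two_rpow_abs_mul (a : ℝ) {s t : ℝ} (hs : 0 < s) (ht : 0 < t) (h₁ : s ≤ 2 * t)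
    (h₂ : t ≤ 2 * s) : s ^ a ≤ 2 ^ |a| * t ^ a := by
  have key : (s / t) ^ a ≤ 2 ^ |a| := by
    rcases le_total 0 a with ha | ha
    · rw [abs_of_nonneg ha]
      exact Real.rpow_le_rpow (by positivity) ((div_le_iff₀ ht).mpr h₁) ha
    · rw [abs_of_nonpos ha, Real.rpow_neg (by positivity), ← Real.inv_rpow (by positivity)]
      have : (s / t) ^ a = (t / s) ^ (-a) := by
        rw [Real.rpow_neg (by positivity), ← Real.inv_rpow (by positivity), inv_div]
      rw [this, Real.inv_rpow (by positivity), ← Real.rpow_neg (by positivity)]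
      exact Real.rpow_le_rpow (by positivity) ((div_le_iff₀ hs).mpr h₂) (by linarith)
  rw [Real.div_rpow hs.le ht.le, div_le_iff₀ (by positivity)] at key
  exact key

lemma normWeight_le_mul (a : ℝ) {x y : Rn n} (hx : x ≠ 0) (hy : y ≠ 0) (h₁ : ‖x‖ ≤ 2 * ‖y‖)
    (h₂ : ‖y‖ ≤ 2 * ‖x‖) : normWeight a x ≤ ENNReal.ofReal (2 ^ |a|) * normWeight a y := by
  rw [normWeight, normWeight, ← ENNReal.ofReal_mul (by positivity)]
  exact ENNReal.ofReal_le_ofReal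
    (rpow_le_two_rpow_abs_mul a (norm_pos_iff.mpr hx) (norm_pos_iff.mpr hy) h₁ h₂)

lemma lintegral_comp_smul {t : ℝ} (ht : 0 < t) (f : Rn n → ℝ≥0∞) :
    ∫⁻ x, f (t • x) = ENNReal.ofReal (t ^ (-(n : ℝ))) * ∫⁻ x, f x := by
  have h := (Homeomorph.smulOfNeZero t ht.ne' : Rn n ≃ₜ Rn n).measurableEmbedding.lintegral_map
    (μ := volume) f
  have h' := Measure.map_addHaar_smul (volume : Measure (Rn n)) ht.ne'
  have e : (⇑(Homeomorph.smulOfNeZero t ht.ne' : Rn n ≃ₜ Rn n)) = fun x => t • x := rfl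
  rw [e, h', lintegral_smul_measure] at h
  rw [← h, smul_eq_mul, finrank_euclideanSpace_fin, abs_of_pos (by positivity),
    Real.rpow_neg ht.le, Real.rpow_natCast]

lemma setLIntegral_outer_comp_smul {t : ℝ} (ht : 0 < t) (r : ℝ) (f : Rn n → ℝ≥0∞) :
    ∫⁻ x in outer n r, f (t • x) =
      ENNReal.ofReal (t ^ (-(n : ℝ))) * ∫⁻ x in outer n (t * r), f x := by
  rw [← lintegral_indicator (measurableSet_outer _), ← lintegral_indicator (measurableSet_outer _),
    ← lintegral_comp_smul ht]
  refine lintegral_congr fun x => ?_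
  have : t • x ∈ outer n (t * r) ↔ x ∈ outer n r := by
    simp [outer, norm_smul, abs_of_pos ht, ht]
  by_cases hx : x ∈ outer n r
  · rw [Set.indicator_of_mem hx, Set.indicator_of_mem (this.mpr hx)]
  · rw [Set.indicator_of_notMem hx, Set.indicator_of_notMem (mt this.mp hx)]

lemma lintegral_closedBall_normWeight {a : ℝ} {R : ℝ} (hR : 0 < R) :
    ∫⁻ x in {x : Rn n | ‖x‖ ≤ R}, normWeight a x =
      ENNReal.ofReal (R ^ (n + a)) * ∫⁻ x in {x : Rn n | ‖x‖ ≤ 1}, normWeight a x := by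
  have hm : ∀ r : ℝ, MeasurableSet {x : Rn n | ‖x‖ ≤ r} := fun r =>
    measurableSet_le measurable_norm measurable_const
  rw [← lintegral_indicator (hm _), ← lintegral_indicator (hm _)]
  have h := lintegral_comp_smul (n := n) (inv_pos.mpr hR)
    ({x : Rn n | ‖x‖ ≤ 1}.indicator (normWeight a))
  have h2 : ∀ x : Rn n, {x : Rn n | ‖x‖ ≤ 1}.indicator (normWeight a) (R⁻¹ • x) =
      ENNReal.ofReal (R⁻¹ ^ a) * {x : Rn n | ‖x‖ ≤ R}.indicator (normWeight a) x := by
    intro x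
    have : ‖R⁻¹ • x‖ ≤ 1 ↔ ‖x‖ ≤ R := by
      rw [norm_smul, norm_inv, Real.norm_of_nonneg hR.le, inv_mul_le_iff₀ hR, mul_one]
    by_cases hx : ‖x‖ ≤ R
    · simp [Set.indicator, this, hx, normWeight_smul a (inv_pos.mpr hR) x]
    · simp [Set.indicator, this, hx]
  simp_rw [h2] at h
  rw [lintegral_const_mul _ ((measurable_normWeight a).indicator (hm _))] at h
  have h3 := congrArg (fun z => ENNReal.ofReal (R ^ a) * z) h
  simp only [← mul_assoc, ← ENNReal.ofReal_mul (show 0 ≤ R ^ a by positivity)] at h3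
  rw [← Real.mul_rpow hR.le (by positivity), mul_inv_cancel₀ hR.ne', Real.one_rpow,
    ENNReal.ofReal_one, one_mul, Real.rpow_neg (by positivity), Real.inv_rpow hR.le, inv_inv,
    ← Real.rpow_add hR] at h3
  rw [h3, add_comm]

lemma lintegral_unitBall_normWeight_lt_top (hn : 0 < n) {a : ℝ} (ha : -(n : ℝ) < a) :
    ∫⁻ x in {x : Rn n | ‖x‖ ≤ 1}, normWeight a x < ⊤ := by
  have : Nonempty (Fin n) := ⟨⟨0, hn⟩⟩
  have : Nontrivial (Rn n) := inferInstance
  -- Polar coordinates reduce to integrability of `t^(n-1+a)` near `0`; the open ball of radius 2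
  -- serves only to contain the closed unit ball.
  have h : IntegrableOn (fun x : Rn n => ‖x‖ ^ a) (Metric.ball 0 2) := by
    refine (integrableOn_fun_norm_addHaar (volume : Measure (Rn n)) (f := fun t : ℝ => t ^ a)).mpr ?_
    have h1 : IntegrableOn (fun t : ℝ => t ^ ((n : ℝ) - 1 + a)) (Set.Ioo 0 2) :=
      (intervalIntegral.integrableOn_Ioo_rpow_iff (by norm_num)).mpr (by linarith)
    refine h1.congr_fun (fun t ht => ?_) measurableSet_Ioo
    simp only [finrank_euclideanSpace_fin, smul_eq_mul]
    rw [Real.rpow_add ht.1, ← Real.rpow_natCast, Nat.cast_sub hn, Nat.cast_one]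
  have h2 := h.mono_set (s := {x : Rn n | ‖x‖ ≤ 1}) (fun x hx => by
    have hx' : ‖x‖ ≤ 1 := hx
    simpa using hx'.trans_lt one_lt_two)
  have := h2.hasFiniteIntegral
  refine lt_of_eq_of_lt (lintegral_congr fun x => ?_) this
  rw [normWeight, Real.enorm_eq_ofReal (by positivity)]

end PowerWeight

/-! ### The mass on balls of functions in weighted Lebesgue spaces -/

section BallMass

variable {n : ℕ} {γ σ s : ℝ}

lemma measurableSet_norm_le (R : ℝ) : MeasurableSet {x : Rn n | ‖x‖ ≤ R} :=
  measurableSet_le measurable_norm measurable_const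

lemma ae_ne_zero (hn : 0 < n) : ∀ᵐ x : Rn n, x ≠ 0 := by
  have : Nonempty (Fin n) := ⟨⟨0, hn⟩⟩
  have : Nontrivial (Rn n) := inferInstance
  exact Measure.ae_ne volume 0

lemma weightedNorm_sq {F : Type*} [NormedAddCommGroup F] (u : Rn n → F) :
    weightedNorm γ σ u ^ 2 = (∫⁻ x, normWeight γ x * ‖u x‖ₑ ^ σ) ^ (2 / σ) := by
  rw [weightedNorm, ← ENNReal.rpow_two, ← ENNReal.rpow_mul]
  congr 1
  ring

/-- Hölder's inequality on the ball of radius `R`. -/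
lemma exists_ballMass_le (hn : 0 < n) (hs : 0 < s) (hσ : 2 ≤ σ) (hγσ : (n + γ) / σ = n / 2 - s) :
    ∃ K : ℝ≥0, ∀ u : Rn n → ℂ, AEStronglyMeasurable u volume → ∀ R : ℝ, 0 < R →
      ballMass s u R ≤ K * weightedNorm γ σ u ^ 2 := by
  have hσ0 : 0 < σ := by linarith
  have hnR : (0 : ℝ) < n := by exact_mod_cast hn
  have hγeq : n + γ = (n / 2 - s) * σ := (div_eq_iff hσ0.ne').mp hγσ
  -- At `σ = 2` the Hölder dual exponent is infinite; there `γ = -2s`, and the pointwise bound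
  -- `|x|^{2s} ≤ R^{2s}` replaces Hölder.
  rcases hσ.eq_or_lt with rfl | hσ2
  · refine ⟨1, fun u hu R hR => ?_⟩
    have hγ : γ = -(2 * s) := by linarith
    rw [weightedNorm_sq, ballMass, ENNReal.coe_one, one_mul, div_self two_ne_zero, ENNReal.rpow_one]
    refine ENNReal.div_le_of_le_mul ?_
    calc ∫⁻ x in {x : Rn n | ‖x‖ ≤ R}, ‖u x‖ₑ ^ 2
        ≤ ∫⁻ x in {x : Rn n | ‖x‖ ≤ R},
            (normWeight γ x * ‖u x‖ₑ ^ (2 : ℝ)) * ENNReal.ofReal (R ^ (2 * s)) := by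
          refine lintegral_mono_ae ?_
          filter_upwards [ae_restrict_of_ae (ae_ne_zero hn),
            ae_restrict_mem (measurableSet_norm_le R)] with x hx0 hxR
          have hxR : ‖x‖ ≤ R := hxR
          calc ‖u x‖ₑ ^ 2 = normWeight γ x * normWeight (2 * s) x * ‖u x‖ₑ ^ 2 := by
                rw [normWeight_mul _ _ hx0, hγ, neg_add_cancel, normWeight_zero, one_mul]
            _ ≤ normWeight γ x * ENNReal.ofReal (R ^ (2 * s)) * ‖u x‖ₑ ^ 2 := by
                gcongr
                exact ENNReal.ofReal_le_ofReal
                  (Real.rpow_le_rpow (norm_nonneg _) hxR (by positivity))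
            _ = _ := by rw [ENNReal.rpow_two]; ring
      _ = (∫⁻ x in {x : Rn n | ‖x‖ ≤ R}, normWeight γ x * ‖u x‖ₑ ^ (2 : ℝ)) *
            ENNReal.ofReal (R ^ (2 * s)) := lintegral_mul_const' _ _ ENNReal.ofReal_ne_top
      _ ≤ _ := by gcongr; exact Measure.restrict_le_self
  -- `α` is the exponent for which `|x|^{2γ/σ} |x|^{α(1-2/σ)} = 1`. Its local integrability, `α >
  -- -n`, amounts to `(n + γ)/σ < n/2`, that is, to `s > 0`.
  · set α : ℝ := -(2 * γ) / (σ - 2) with hα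
    have hσ2' : 0 < σ - 2 := by linarith
    have hαn : -(n : ℝ) < α := by
      rw [hα, lt_div_iff₀ hσ2']
      nlinarith
    have hα1 : α * (1 - 2 / σ) = -(2 * γ / σ) := by
      rw [hα]; field_simp
    have hexp : (n + α) * (1 - 2 / σ) = 2 * s := by
      have : (n + γ) / σ = n / σ + γ / σ := add_div _ _ _
      have h2 : (n : ℝ) * (1 - 2 / σ) = n - 2 * (n / σ) := by ring
      rw [add_mul, hα1, h2]
      have h3 : 2 * γ / σ = 2 * (γ / σ) := by ring
      linarith
    have ht : 0 ≤ 1 - 2 / σ := by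
      rw [sub_nonneg, div_le_one hσ0]; exact hσ
    have hK := (ENNReal.rpow_lt_top_of_nonneg ht
      (lintegral_unitBall_normWeight_lt_top hn hαn).ne).ne
    refine ⟨((∫⁻ x in {x : Rn n | ‖x‖ ≤ 1}, normWeight α x) ^ (1 - 2 / σ)).toNNReal,
      fun u hu R hR => ?_⟩
    rw [ENNReal.coe_toNNReal hK, weightedNorm_sq, ballMass]
    refine ENNReal.div_le_of_le_mul ?_
    calc ∫⁻ x in {x : Rn n | ‖x‖ ≤ R}, ‖u x‖ₑ ^ 2
        = ∫⁻ x in {x : Rn n | ‖x‖ ≤ R},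
            (normWeight γ x * ‖u x‖ₑ ^ σ) ^ (2 / σ) * normWeight α x ^ (1 - 2 / σ) := by
          refine lintegral_congr_ae (ae_restrict_of_ae ?_)
          filter_upwards [ae_ne_zero hn] with x hx0
          rw [ENNReal.mul_rpow_of_nonneg _ _ (by positivity), normWeight_rpow _ (by positivity),
            normWeight_rpow _ ht, mul_right_comm, normWeight_mul _ _ hx0, hα1, ← ENNReal.rpow_mul,
            mul_div_cancel₀ _ hσ0.ne', show γ * (2 / σ) + -(2 * γ / σ) = 0 by ring,
            normWeight_zero, one_mul, ENNReal.rpow_two]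
      _ ≤ (∫⁻ x in {x : Rn n | ‖x‖ ≤ R}, normWeight γ x * ‖u x‖ₑ ^ σ) ^ (2 / σ) *
            (∫⁻ x in {x : Rn n | ‖x‖ ≤ R}, normWeight α x) ^ (1 - 2 / σ) := by
          refine ENNReal.lintegral_mul_norm_pow_le ?_ (by fun_prop) (by positivity) ht (by ring)
          exact (by fun_prop : AEMeasurable (normWeight γ) _).mul
            (hu.restrict.enorm.pow_const σ)
      _ ≤ (∫⁻ x, normWeight γ x * ‖u x‖ₑ ^ σ) ^ (2 / σ) *
            (∫⁻ x in {x : Rn n | ‖x‖ ≤ R}, normWeight α x) ^ (1 - 2 / σ) := by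
          gcongr
          exact Measure.restrict_le_self
      _ = _ := by
          rw [lintegral_closedBall_normWeight hR, ENNReal.mul_rpow_of_nonneg _ _ ht,
            ENNReal.ofReal_rpow_of_nonneg (by positivity) ht, ← Real.rpow_mul hR.le, hexp]
          ring

/-- The bound of `exists_ballMass_le` is uniform in `R`, so it suffices to approximate `u` in norm
by functions supported in a fixed ball, whose scaled mass decays like `R^{-2s}`. -/
lemma tendsto_ballMass_zero (hn : 0 < n) (hs : 0 < s) (hσ : 2 ≤ σ)
    (hγσ : (n + γ) / σ = n / 2 - s) {u : Rn n → ℂ} (hu : MemWeightedLp γ σ u) :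
    Tendsto (fun R : ℝ => ballMass s u R) atTop (𝓝 0) := by
  have hσ0 : 0 < σ := by linarith
  obtain ⟨K, hK⟩ := exists_ballMass_le hn hs hσ hγσ
  have hfin : ∫⁻ x, normWeight γ x * ‖u x‖ₑ ^ σ ≠ ⊤ := by
    intro h
    have := hu.2
    rw [weightedNorm] at this
    change (∫⁻ x, normWeight γ x * ‖u x‖ₑ ^ σ) ^ (1 / σ) < ⊤ at this
    rw [h, ENNReal.top_rpow_of_pos (by positivity)] at this
    exact this.false
  let v : ℕ → Rn n → ℂ := fun k => {x : Rn n | (k : ℝ) < ‖x‖}.indicator u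
  have hmk : ∀ k : ℕ, MeasurableSet {x : Rn n | (k : ℝ) < ‖x‖} := fun k =>
    measurableSet_lt measurable_const measurable_norm
  have hv : ∀ k, AEStronglyMeasurable (v k) volume := fun k => hu.1.indicator (hmk k)
  have hlim : Tendsto (fun k => ∫⁻ x, normWeight γ x * ‖v k x‖ₑ ^ σ) atTop (𝓝 0) := by
    rw [← lintegral_zero (μ := (volume : Measure (Rn n)))]
    refine tendsto_lintegral_of_dominated_convergence' (fun x => normWeight γ x * ‖u x‖ₑ ^ σ)
      (fun k => (measurable_normWeight γ).aemeasurable.mul ((hv k).enorm.pow_const σ))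
      (fun k => ae_of_all _ fun x => ?_) hfin (ae_of_all _ fun x => ?_)
    · refine mul_le_mul_right (ENNReal.rpow_le_rpow ?_ hσ0.le) _
      by_cases hx : x ∈ {x : Rn n | (k : ℝ) < ‖x‖}
      · exact (congrArg (‖·‖ₑ) (Set.indicator_of_mem hx u)).le
      · exact (congrArg (‖·‖ₑ) (Set.indicator_of_notMem hx u)).le.trans (by simp)
    · refine tendsto_const_nhds.congr' ?_
      filter_upwards [eventually_ge_atTop ⌈‖x‖⌉₊] with k hk
      have : x ∉ {x : Rn n | (k : ℝ) < ‖x‖} := not_lt.mpr (Nat.ceil_le.mp hk)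
      simp [v, Set.indicator_of_notMem this, hσ0]
  have hlim2 : Tendsto (fun k => (K : ℝ≥0∞) * weightedNorm γ σ (v k) ^ 2) atTop (𝓝 0) := by
    simp_rw [weightedNorm_sq]
    have h1 := (ENNReal.continuous_rpow_const (y := 2 / σ)).tendsto 0 |>.comp hlim
    rw [ENNReal.zero_rpow_of_pos (by positivity)] at h1
    simpa using ENNReal.Tendsto.const_mul h1 (Or.inr ENNReal.coe_ne_top)
  rw [ENNReal.tendsto_nhds_zero]
  intro ε hε
  have hε2 : 0 < ε / 2 := ENNReal.half_pos hε.ne'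
  obtain ⟨k, hk, hk0⟩ := (((ENNReal.tendsto_nhds_zero.mp hlim2) _ hε2).and
    (eventually_gt_atTop 0)).exists
  have hk0' : (0 : ℝ) < k := by exact_mod_cast hk0
  set A := ∫⁻ x in {x : Rn n | ‖x‖ ≤ k}, ‖u x‖ₑ ^ 2 with hA
  -- The mass of the fixed ball is finite by the Hölder bound at radius `k`, which is why `k` was
  -- chosen positive.
  have hAfin : A ≠ ⊤ := by
    intro h
    have h1 := hK u hu.1 k hk0'
    rw [ballMass, ← hA, h, ENNReal.top_div_of_ne_top ENNReal.ofReal_ne_top] at h1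
    exact (h1.trans_lt (ENNReal.mul_lt_top ENNReal.coe_lt_top (ENNReal.pow_lt_top hu.2))).false
  have hdec : Tendsto (fun R : ℝ => A / ENNReal.ofReal (R ^ (2 * s))) atTop (𝓝 0) := by
    have h1 : Tendsto (fun R : ℝ => ENNReal.ofReal (R ^ (2 * s))) atTop (𝓝 ⊤) :=
      ENNReal.tendsto_ofReal_nhds_top.mpr (tendsto_rpow_atTop (by positivity))
    simpa using ENNReal.Tendsto.const_div h1 (Or.inr hAfin)
  filter_upwards [(ENNReal.tendsto_nhds_zero.mp hdec) _ hε2, eventually_gt_atTop 0] with R hR hR0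
  calc ballMass s u R
      ≤ A / ENNReal.ofReal (R ^ (2 * s)) + ballMass s (v k) R := by
        rw [ballMass, ballMass, ENNReal.div_add_div_same]
        gcongr
        calc ∫⁻ x in {x : Rn n | ‖x‖ ≤ R}, ‖u x‖ₑ ^ 2
            ≤ ∫⁻ x in {x : Rn n | ‖x‖ ≤ R},
              ({x : Rn n | ‖x‖ ≤ k}.indicator (fun x => ‖u x‖ₑ ^ 2) x + ‖v k x‖ₑ ^ 2) := by
              refine lintegral_mono fun x => ?_
              by_cases hx : ‖x‖ ≤ k
              · rw [Set.indicator_of_mem (show x ∈ {x : Rn n | ‖x‖ ≤ k} from hx)]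
                exact le_self_add
              · have : v k x = u x :=
                  Set.indicator_of_mem (show x ∈ {x : Rn n | (k : ℝ) < ‖x‖} from not_le.mp hx) u
                rw [this]
                exact le_add_self
          _ = (∫⁻ x in {x : Rn n | ‖x‖ ≤ R},
                {x : Rn n | ‖x‖ ≤ k}.indicator (fun x => ‖u x‖ₑ ^ 2) x) +
              ∫⁻ x in {x : Rn n | ‖x‖ ≤ R}, ‖v k x‖ₑ ^ 2 :=
              lintegral_add_right' _ ((hv k).restrict.enorm.pow_const 2)
          _ ≤ _ := by
              refine add_le_add_left ((setLIntegral_le_lintegral _ _).trans ?_) _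
              rw [lintegral_indicator (measurableSet_norm_le _)]
    _ ≤ ε / 2 + ε / 2 := add_le_add hR ((hK (v k) (hv k) R hR0).trans hk)
    _ = ε := ENNReal.add_halves ε

end BallMass

/-! ### A Hardy inequality on exterior domains -/

section Hardy

variable {n : ℕ} {b : ℝ}

/-- The Cauchy–Schwarz inequality with a weight. -/
lemma sq_lintegral_mul_le {α : Type*} [MeasurableSpace α] {μ : Measure α} {w f : α → ℝ≥0∞}
    (hw : AEMeasurable w μ) (hf : AEMeasurable f μ) :
    (∫⁻ a, w a * f a ∂μ) ^ 2 ≤ (∫⁻ a, w a ∂μ) * ∫⁻ a, w a * f a ^ 2 ∂μ := by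
  have h := ENNReal.lintegral_mul_norm_pow_le hw (hw.mul (hf.pow_const 2))
    (p := 1 / 2) (q := 1 / 2) (by norm_num) (by norm_num) (by norm_num)
  have e : ∀ a, w a ^ (1 / 2 : ℝ) * (w a * f a ^ 2) ^ (1 / 2 : ℝ) = w a * f a := fun a => by
    rw [ENNReal.mul_rpow_of_nonneg _ _ (by norm_num), ← mul_assoc,
      ← ENNReal.rpow_add_of_nonneg _ _ (by norm_num) (by norm_num), ← ENNReal.rpow_two,
      ← ENNReal.rpow_mul]
    norm_num
  simp only [Pi.mul_apply, e] at h
  refine (pow_le_pow_left' h 2).trans_eq ?_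
  rw [mul_pow, ← ENNReal.rpow_two, ← ENNReal.rpow_two, ← ENNReal.rpow_mul, ← ENNReal.rpow_mul]
  norm_num

lemma enorm_sq_eq_normWeight (x : Rn n) : ‖x‖ₑ ^ 2 = normWeight 2 x := by
  rw [normWeight, Real.rpow_two, ENNReal.ofReal_pow (norm_nonneg _), ofReal_norm]

/-- Fundamental theorem of calculus along the segment from `x` to `2x`, then Cauchy–Schwarz in `t`;
the constant is 1 because the interval has length 1. -/
lemma enorm_sub_comp_two_smul_sq_le {v : Rn n → ℂ} (hv : ContDiff ℝ 1 v) (x : Rn n) :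
    ‖v x - v ((2 : ℝ) • x)‖ₑ ^ 2 ≤
      normWeight 2 x * ∫⁻ t in Set.Ioc (1 : ℝ) 2, ‖fderiv ℝ v (t • x)‖ₑ ^ 2 := by
  have hc : Continuous fun t : ℝ => fderiv ℝ v (t • x) :=
    (hv.continuous_fderiv one_ne_zero).comp (by fun_prop)
  have hd : ∀ t : ℝ, HasDerivAt (fun t : ℝ => v (t • x)) (fderiv ℝ v (t • x) x) t := fun t => by
    have h1 : HasDerivAt (fun t : ℝ => t • x) x t := by
      simpa using (hasDerivAt_id t).smul_const x
    exact ((hv.differentiable one_ne_zero) (t • x)).hasFDerivAt.comp_hasDerivAt t h1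
  have hint := intervalIntegral.integral_eq_sub_of_hasDerivAt (a := 1) (b := 2)
    (fun t _ => hd t) ((hc.clm_apply continuous_const).intervalIntegrable _ _)
  rw [one_smul, intervalIntegral.integral_of_le one_le_two] at hint
  have h1 : ‖v x - v ((2 : ℝ) • x)‖ₑ ≤
      ‖x‖ₑ * ∫⁻ t in Set.Ioc (1 : ℝ) 2, 1 * ‖fderiv ℝ v (t • x)‖ₑ := by
    rw [← enorm_neg, neg_sub, ← hint]
    refine (enorm_integral_le_lintegral_enorm _).trans ?_
    rw [← lintegral_const_mul' _ _ enorm_ne_top]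
    refine lintegral_mono fun t => ?_
    rw [one_mul, mul_comm]
    exact ContinuousLinearMap.le_opENorm _ _
  refine (pow_le_pow_left' h1 2).trans ?_
  rw [mul_pow, enorm_sq_eq_normWeight]
  gcongr
  refine (sq_lintegral_mul_le aemeasurable_const hc.enorm.measurable.aemeasurable).trans_eq ?_
  simp [Real.volume_Ioc]
  norm_num

/-- Change of variables, together with the fact that a dilation by `t ≥ 1` maps the exterior region
into itself. This is why no boundary term appears in the Hardy inequality. -/
lemma setLIntegral_outer_normWeight_comp_smul_le {a t r : ℝ} (ht : 1 ≤ t) (hr : 0 < r)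
    (f : Rn n → ℝ≥0∞) :
    ∫⁻ x in outer n r, normWeight a x * f (t • x) ≤
      ENNReal.ofReal (t ^ (-(n + a))) * ∫⁻ x in outer n r, normWeight a x * f x := by
  have ht0 : 0 < t := one_pos.trans_le ht
  calc ∫⁻ x in outer n r, normWeight a x * f (t • x)
      = ∫⁻ x in outer n r, ENNReal.ofReal (t ^ (-a)) * (normWeight a (t • x) * f (t • x)) := by
        refine lintegral_congr fun x => ?_
        rw [normWeight_smul a ht0, ← mul_assoc, ← mul_assoc, ← ENNReal.ofReal_mul (by positivity),
          ← Real.rpow_add ht0, neg_add_cancel, Real.rpow_zero, ENNReal.ofReal_one, one_mul]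
    _ = ENNReal.ofReal (t ^ (-a)) *
          ∫⁻ x in outer n r, (fun y => normWeight a y * f y) (t • x) :=
        lintegral_const_mul' _ _ ENNReal.ofReal_ne_top
    _ = ENNReal.ofReal (t ^ (-(n + a))) * ∫⁻ x in outer n (t * r), normWeight a x * f x := by
        rw [setLIntegral_outer_comp_smul ht0 r (fun y => normWeight a y * f y), ← mul_assoc, ← ENNReal.ofReal_mul (by positivity),
          ← Real.rpow_add ht0]
        congr 3
        ring
    _ ≤ _ := by
        gcongr
        exact outer_subset (le_mul_of_one_le_left hr.le ht)

lemma setLIntegral_outer_sub_comp_two_smul_le (hb : 0 ≤ n + b) {r : ℝ} (hr : 0 < r)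
    {v : Rn n → ℂ} (hv : ContDiff ℝ 1 v) :
    ∫⁻ x in outer n r, normWeight (b - 2) x * ‖v x - v ((2 : ℝ) • x)‖ₑ ^ 2 ≤
      ∫⁻ x in outer n r, normWeight b x * ‖fderiv ℝ v x‖ₑ ^ 2 := by
  have hc : Continuous fun z : Rn n × ℝ => fderiv ℝ v (z.2 • z.1) :=
    (hv.continuous_fderiv one_ne_zero).comp (by fun_prop)
  calc ∫⁻ x in outer n r, normWeight (b - 2) x * ‖v x - v ((2 : ℝ) • x)‖ₑ ^ 2
      ≤ ∫⁻ x in outer n r, ∫⁻ t in Set.Ioc (1 : ℝ) 2,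
          normWeight b x * ‖fderiv ℝ v (t • x)‖ₑ ^ 2 := by
        refine setLIntegral_mono' (measurableSet_outer r) fun x hx => ?_
        rw [lintegral_const_mul' _ _ (normWeight_ne_top _ _)]
        calc normWeight (b - 2) x * ‖v x - v ((2 : ℝ) • x)‖ₑ ^ 2
            ≤ normWeight (b - 2) x *
                (normWeight 2 x * ∫⁻ t in Set.Ioc (1 : ℝ) 2, ‖fderiv ℝ v (t • x)‖ₑ ^ 2) := by
              gcongr
              exact enorm_sub_comp_two_smul_sq_le hv x
          _ = _ := by
              rw [← mul_assoc, normWeight_mul _ _ (ne_zero_of_mem_outer hr hx), sub_add_cancel]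
    _ = ∫⁻ t in Set.Ioc (1 : ℝ) 2, ∫⁻ x in outer n r,
          normWeight b x * ‖fderiv ℝ v (t • x)‖ₑ ^ 2 := by
        refine lintegral_lintegral_swap ?_
        refine AEMeasurable.mul ?_ (hc.enorm.measurable.pow_const 2).aemeasurable
        exact ((measurable_normWeight b).comp measurable_fst).aemeasurable
    _ ≤ ∫⁻ t in Set.Ioc (1 : ℝ) 2, ∫⁻ x in outer n r, normWeight b x * ‖fderiv ℝ v x‖ₑ ^ 2 := by
        refine setLIntegral_mono' measurableSet_Ioc fun t ht => ?_
        refine (setLIntegral_outer_normWeight_comp_smul_le ht.1.le hr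
          (fun y => ‖fderiv ℝ v y‖ₑ ^ 2)).trans (mul_le_of_le_one_left' ?_)
        exact ENNReal.ofReal_le_one.mpr (Real.rpow_le_one_of_one_le_of_nonpos ht.1.le (by linarith))
    _ = _ := by
        simp [Real.volume_Ioc]
        norm_num

/-- Hardy's inequality on `{|x| ≥ r}`, for functions with finite left-hand side. -/
lemma exists_hardy_outer (hb : 0 < n + b - 2) :
    ∃ C : ℝ≥0, ∀ r : ℝ, 0 < r → ∀ v : Rn n → ℂ, ContDiff ℝ 1 v →
      ∫⁻ x in outer n r, normWeight (b - 2) x * ‖v x‖ₑ ^ 2 ≠ ⊤ →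
      ∫⁻ x in outer n r, normWeight (b - 2) x * ‖v x‖ₑ ^ 2 ≤
        C * ∫⁻ x in outer n r, normWeight b x * ‖fderiv ℝ v x‖ₑ ^ 2 := by
  -- A bound for the norm of `v ↦ v(2·)` on `L²(|x|^{b-2} dx)` over the exterior region; it is below
  -- 1 exactly when `n + b - 2 > 0`.
  set q : ℝ≥0∞ := ENNReal.ofReal (2 ^ (-(n + (b - 2)))) ^ (1 / 2 : ℝ) with hq
  have hq1 : q < 1 := by
    refine ENNReal.rpow_lt_one ?_ (by norm_num)
    rw [ENNReal.ofReal_lt_one]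
    exact Real.rpow_lt_one_of_one_lt_of_neg one_lt_two (by linarith)
  have hqinv : ((1 - q)⁻¹) ^ 2 ≠ ⊤ :=
    ENNReal.pow_ne_top (ENNReal.inv_ne_top.mpr (tsub_pos_of_lt hq1).ne')
  refine ⟨(((1 - q)⁻¹) ^ 2).toNNReal, fun r hr v hv hfin => ?_⟩
  rw [ENNReal.coe_toNNReal hqinv]
  set D := ∫⁻ x in outer n r, normWeight b x * ‖fderiv ℝ v x‖ₑ ^ 2 with hD
  set I := ∫⁻ x in outer n r, normWeight (b - 2) x * ‖v x‖ₑ ^ 2 with hI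
  have hsq : ∀ (x : Rn n) (z : ℂ), (normWeight ((b - 2) / 2) x * ‖z‖ₑ) ^ (2 : ℝ) =
      normWeight (b - 2) x * ‖z‖ₑ ^ 2 := fun x z => by
    rw [ENNReal.mul_rpow_of_nonneg _ _ (by norm_num), normWeight_rpow _ (by norm_num),
      ENNReal.rpow_two]
    congr 2
    ring
  have hvc := hv.continuous
  have htri : I ^ (1 / 2 : ℝ) ≤ D ^ (1 / 2 : ℝ) + q * I ^ (1 / 2 : ℝ) := by
    have h := ENNReal.lintegral_Lp_add_le (μ := volume.restrict (outer n r)) (p := 2)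
      (f := fun x => normWeight ((b - 2) / 2) x * ‖v x - v ((2 : ℝ) • x)‖ₑ)
      (g := fun x => normWeight ((b - 2) / 2) x * ‖v ((2 : ℝ) • x)‖ₑ)
      ((measurable_normWeight _).mul
        (show Continuous fun x => v x - v ((2 : ℝ) • x) by fun_prop).enorm.measurable).aemeasurable
      ((measurable_normWeight _).mul
        (show Continuous fun x => v ((2 : ℝ) • x) by fun_prop).enorm.measurable).aemeasurable
      one_le_two
    simp only [hsq] at h
    refine le_trans ?_ (h.trans ?_)
    · refine ENNReal.rpow_le_rpow (lintegral_mono fun x => ?_) (by norm_num)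
      rw [← hsq]
      refine ENNReal.rpow_le_rpow ?_ (by norm_num)
      simp only [Pi.add_apply, ← mul_add]
      gcongr
      calc ‖v x‖ₑ = ‖(v x - v ((2 : ℝ) • x)) + v ((2 : ℝ) • x)‖ₑ := by rw [sub_add_cancel]
        _ ≤ _ := enorm_add_le _ _
    · refine add_le_add (ENNReal.rpow_le_rpow
        (setLIntegral_outer_sub_comp_two_smul_le (by linarith) hr hv) (by norm_num)) ?_
      rw [hq, ← ENNReal.mul_rpow_of_nonneg _ _ (by norm_num)]
      exact ENNReal.rpow_le_rpow (setLIntegral_outer_normWeight_comp_smul_le one_le_two hr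
        (fun y => ‖v y‖ₑ ^ 2)) (by norm_num)
  -- Finiteness is what allows `q I^{1/2}` to be subtracted from both sides of the triangle
  -- inequality.
  have hI2 : I ^ (1 / 2 : ℝ) ≠ ⊤ := ENNReal.rpow_ne_top_of_nonneg (by norm_num) hfin
  have hmul : (1 - q) * I ^ (1 / 2 : ℝ) ≤ D ^ (1 / 2 : ℝ) := by
    rw [ENNReal.sub_mul (fun _ _ => hI2), one_mul]
    exact tsub_le_iff_right.mpr htri
  have hle : I ^ (1 / 2 : ℝ) ≤ (1 - q)⁻¹ * D ^ (1 / 2 : ℝ) := by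
    rw [mul_comm, ← div_eq_mul_inv]
    exact (ENNReal.le_div_iff_mul_le (Or.inl (tsub_pos_of_lt hq1).ne')
      (Or.inl (ENNReal.sub_ne_top ENNReal.one_ne_top))).mpr (by rwa [mul_comm])
  have := pow_le_pow_left' hle 2
  rw [mul_pow, ← ENNReal.rpow_two, ← ENNReal.rpow_two, ← ENNReal.rpow_two, ← ENNReal.rpow_mul,
    ← ENNReal.rpow_mul] at this
  norm_num at this
  exact this

end Hardy

/-! ### A weighted Sobolev inequality on exterior domains -/

section Sobolev

variable {n : ℕ} {b : ℝ}

/-- A smooth step, equal to `0` on `(-∞, 1]` and to `1` on `[2, ∞)`. -/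
noncomputable def smoothStep (t : ℝ) : ℝ := Real.smoothTransition (t - 1)

lemma contDiff_smoothStep : ContDiff ℝ 1 smoothStep :=
  Real.smoothTransition.contDiff.comp (contDiff_id.sub contDiff_const)

lemma smoothStep_of_le_one {t : ℝ} (ht : t ≤ 1) : smoothStep t = 0 :=
  Real.smoothTransition.zero_of_nonpos (by linarith)

lemma smoothStep_of_two_le {t : ℝ} (ht : 2 ≤ t) : smoothStep t = 1 :=
  Real.smoothTransition.one_of_one_le (by linarith)

lemma smoothStep_nonneg (t : ℝ) : 0 ≤ smoothStep t := Real.smoothTransition.nonneg _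

lemma smoothStep_le_one (t : ℝ) : smoothStep t ≤ 1 := Real.smoothTransition.le_one _

/-- The quantity `t S'(t)` is invariant under rescaling of the cut-off, so one bound makes the
derivatives of all rescaled cut-offs `O(1/t)`, uniformly in the scale. -/
lemma exists_abs_deriv_smoothStep_mul_le :
    ∃ K : ℝ, 0 ≤ K ∧ ∀ t : ℝ, |deriv smoothStep t * t| ≤ K := by
  have hc : Continuous fun t : ℝ => deriv smoothStep t * t :=
    (contDiff_smoothStep.continuous_deriv le_rfl).mul continuous_id
  obtain ⟨K, hK⟩ := (isCompact_Icc (a := (1 : ℝ)) (b := 2)).exists_bound_of_continuousOn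
    hc.continuousOn
  have hK0 : 0 ≤ K := (norm_nonneg _).trans (hK 1 ⟨le_rfl, one_le_two⟩)
  refine ⟨K, hK0, fun t => ?_⟩
  by_cases ht : t ∈ Set.Icc (1 : ℝ) 2
  · exact hK t ht
  · have h0 : deriv smoothStep t = 0 := by
      rw [Set.mem_Icc, not_and_or, not_le, not_le] at ht
      rcases ht with ht | ht
      · have : smoothStep =ᶠ[𝓝 t] fun _ => 0 := by
          filter_upwards [Iio_mem_nhds ht] with s hs using smoothStep_of_le_one (le_of_lt hs)
        rw [this.deriv_eq, deriv_const]
      · have : smoothStep =ᶠ[𝓝 t] fun _ => 1 := by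
          filter_upwards [Ioi_mem_nhds ht] with s hs using smoothStep_of_two_le (le_of_lt hs)
        rw [this.deriv_eq, deriv_const]
    simpa [h0] using hK0

/-- The profile `t^β`, cut off near the origin (below `R / 2`) and near infinity (above `2 T`). -/
noncomputable def cutPower (β R T t : ℝ) : ℝ :=
  t ^ β * (smoothStep (2 * t / R) * (1 - smoothStep (t / T)))

variable {β R T : ℝ}

lemma cutPower_of_le (hR : 0 < R) {t : ℝ} (ht : t ≤ R / 2) : cutPower β R T t = 0 := by
  rw [cutPower, smoothStep_of_le_one ((div_le_one hR).mpr (by linarith))]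
  simp

lemma cutPower_of_ge (hT : 0 < T) {t : ℝ} (ht : 2 * T ≤ t) : cutPower β R T t = 0 := by
  rw [cutPower, smoothStep_of_two_le (t := t / T) ((le_div_iff₀ hT).mpr ht)]
  simp

lemma cutPower_of_mem (hR : 0 < R) (hT : 0 < T) {t : ℝ} (h₁ : R ≤ t) (h₂ : t ≤ T) :
    cutPower β R T t = t ^ β := by
  rw [cutPower, smoothStep_of_two_le ((le_div_iff₀ hR).mpr (by linarith)),
    smoothStep_of_le_one ((div_le_one hT).mpr h₂)]
  simp

lemma abs_cutPower_le {t : ℝ} (ht : 0 ≤ t) : |cutPower β R T t| ≤ t ^ β := by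
  rw [cutPower, abs_mul, abs_of_nonneg (Real.rpow_nonneg ht β)]
  refine mul_le_of_le_one_right (by positivity) ?_
  rw [abs_mul, abs_of_nonneg (smoothStep_nonneg _),
    abs_of_nonneg (sub_nonneg.mpr (smoothStep_le_one _))]
  exact mul_le_one₀ (smoothStep_le_one _) (sub_nonneg.mpr (smoothStep_le_one _))
    (by linarith [smoothStep_nonneg (t / T)])

lemma contDiffAt_cutPower {t : ℝ} (ht : 0 < t) : ContDiffAt ℝ 1 (cutPower β R T) t := by
  unfold cutPower
  have h1 : ContDiffAt ℝ 1 (fun t : ℝ => t ^ β) t :=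
    Real.contDiffAt_rpow_const_of_ne ht.ne'
  have h2 : ContDiff ℝ 1 fun t : ℝ => smoothStep (2 * t / R) :=
    contDiff_smoothStep.comp (by fun_prop)
  have h3 : ContDiff ℝ 1 fun t : ℝ => smoothStep (t / T) :=
    contDiff_smoothStep.comp (by fun_prop)
  exact h1.mul (h2.contDiffAt.mul (contDiffAt_const.sub h3.contDiffAt))

/-- The point is that `L` does not depend on `R` or `T`: the cut-offs cost no more than
differentiating `t^β`, and `T` may tend to infinity. -/
lemma exists_abs_deriv_cutPower_le (β : ℝ) :
    ∃ L : ℝ, 0 ≤ L ∧ ∀ R T t : ℝ, 0 < t → |deriv (cutPower β R T) t| ≤ L * t ^ (β - 1) := by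
  obtain ⟨K, hK0, hK⟩ := exists_abs_deriv_smoothStep_mul_le
  refine ⟨|β| + 2 * K, by positivity, fun R T t ht => ?_⟩
  have hS : ∀ s, HasDerivAt smoothStep (deriv smoothStep s) s := fun s =>
    (contDiff_smoothStep.differentiable one_ne_zero s).hasDerivAt
  have h1 : HasDerivAt (fun t : ℝ => t ^ β) (β * t ^ (β - 1)) t :=
    Real.hasDerivAt_rpow_const (Or.inl ht.ne')
  have h2 : HasDerivAt (fun t : ℝ => smoothStep (2 * t / R))
      (deriv smoothStep (2 * t / R) * (2 * 1 / R)) t :=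
    (hS _).comp t (((hasDerivAt_id t).const_mul 2).div_const R)
  have h3 : HasDerivAt (fun t : ℝ => smoothStep (t / T))
      (deriv smoothStep (t / T) * (1 / T)) t :=
    (hS _).comp t ((hasDerivAt_id t).div_const T)
  have h4 := (h1.mul (h2.mul (h3.const_sub 1))).deriv
  have e : deriv (cutPower β R T) t = _ := h4
  rw [e]
  set A := smoothStep (2 * t / R)
  set B := smoothStep (t / T)
  set A' := deriv smoothStep (2 * t / R)
  set B' := deriv smoothStep (t / T)
  have hA' : |A' * (2 * t / R)| ≤ K := hK _
  have hB' : |B' * (t / T)| ≤ K := hK _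
  have hpow : t ^ β = t ^ (β - 1) * t := by
    rw [← Real.rpow_add_one ht.ne', sub_add_cancel]
  have hA0 : 0 ≤ A := smoothStep_nonneg _
  have hA1 : A ≤ 1 := smoothStep_le_one _
  have hB0 : 0 ≤ B := smoothStep_nonneg _
  have hB1 : B ≤ 1 := smoothStep_le_one _
  have e2 : β * t ^ (β - 1) * (A * (1 - B)) +
      t ^ β * (A' * (2 * 1 / R) * (1 - B) + A * -(B' * (1 / T))) =
      (β * (A * (1 - B)) + (A' * (2 * t / R)) * (1 - B) - A * (B' * (t / T))) * t ^ (β - 1) := by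
    rw [hpow]; ring
  have hp : 0 ≤ t ^ (β - 1) := by positivity
  refine (congrArg abs e2).trans_le ?_
  rw [abs_mul, abs_of_nonneg hp]
  refine mul_le_mul_of_nonneg_right ?_ hp
  have b1 : |β * (A * (1 - B))| ≤ |β| := by
    rw [abs_mul, abs_of_nonneg (mul_nonneg hA0 (sub_nonneg.mpr hB1))]
    exact mul_le_of_le_one_right (abs_nonneg _)
      (mul_le_one₀ hA1 (sub_nonneg.mpr hB1) (by linarith))
  have b2 : |(A' * (2 * t / R)) * (1 - B)| ≤ K := by
    rw [abs_mul, abs_of_nonneg (sub_nonneg.mpr hB1)]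
    exact (mul_le_of_le_one_right (abs_nonneg _) (by linarith)).trans hA'
  have b3 : |A * (B' * (t / T))| ≤ K := by
    rw [abs_mul, abs_of_nonneg hA0]
    exact (mul_le_of_le_one_left (abs_nonneg _) hA1).trans hB'
  calc _ ≤ |β * (A * (1 - B)) + (A' * (2 * t / R)) * (1 - B)| + |A * (B' * (t / T))| := abs_sub _ _
    _ ≤ |β * (A * (1 - B))| + |(A' * (2 * t / R)) * (1 - B)| + |A * (B' * (t / T))| := by
        gcongr; exact abs_add_le _ _
    _ ≤ _ := by linarith

lemma eventually_cutPower_norm_eq_zero (hR : 0 < R) {x : Rn n} (hx : ‖x‖ < R / 2) :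
    (fun y : Rn n => cutPower β R T ‖y‖) =ᶠ[𝓝 x] fun _ => 0 := by
  filter_upwards [(continuous_norm.tendsto x).eventually_lt_const hx] with y hy
  exact cutPower_of_le hR hy.le

lemma contDiff_cutPower_norm (hR : 0 < R) :
    ContDiff ℝ 1 fun x : Rn n => cutPower β R T ‖x‖ := by
  rw [contDiff_iff_contDiffAt]
  intro x
  -- The norm is not differentiable at the origin, but the inner cut-off vanishes in a neighbourhood
  -- of it.
  by_cases hx : x = 0
  · refine contDiffAt_const.congr_of_eventuallyEq
      (eventually_cutPower_norm_eq_zero hR (by simpa [hx] using hR))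
  · exact (contDiffAt_cutPower (norm_pos_iff.mpr hx)).comp x (contDiffAt_norm ℝ hx)

lemma norm_fderiv_cutPower_norm_le {x : Rn n} (hx : x ≠ 0) :
    ‖fderiv ℝ (fun y : Rn n => cutPower β R T ‖y‖) x‖ ≤ |deriv (cutPower β R T) ‖x‖| := by
  have h1 : HasDerivAt (cutPower β R T) (deriv (cutPower β R T) ‖x‖) ‖x‖ :=
    ((contDiffAt_cutPower (norm_pos_iff.mpr hx)).differentiableAt one_ne_zero).hasDerivAt
  have h2 : HasFDerivAt (fun y : Rn n => ‖y‖) (fderiv ℝ (fun y : Rn n => ‖y‖) x) x :=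
    ((contDiffAt_norm ℝ hx (n := 1)).differentiableAt one_ne_zero).hasFDerivAt
  have h3 := (h1.comp_hasFDerivAt x h2).fderiv
  change fderiv ℝ (fun y : Rn n => cutPower β R T ‖y‖) x = _ at h3
  rw [h3, norm_smul, Real.norm_eq_abs]
  refine mul_le_of_le_one_right (abs_nonneg _) ?_
  simpa using norm_fderiv_le_of_lipschitz ℝ (x₀ := x) (lipschitzWith_one_norm (E := Rn n))

/-- Product rule and `(a + b)² ≤ 2a² + 2b²`: the first term is the weighted gradient, the second is
the Hardy integrand. The indicator comes from the vanishing of the cut-off below radius `R / 2`. -/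
lemma enorm_fderiv_cutPower_smul_sq_le {L : ℝ}
    (hL : ∀ R T t : ℝ, 0 < t → |deriv (cutPower (b / 2) R T) t| ≤ L * t ^ (b / 2 - 1))
    (hR : 0 < R) {v : Rn n → ℂ} (hv : ContDiff ℝ 1 v) (x : Rn n) :
    ‖fderiv ℝ (fun y => cutPower (b / 2) R T ‖y‖ • v y) x‖ₑ ^ 2 ≤
      (outer n (R / 2)).indicator (fun x => 2 * (normWeight b x * ‖fderiv ℝ v x‖ₑ ^ 2) +
        2 * (ENNReal.ofReal (L ^ 2) * (normWeight (b - 2) x * ‖v x‖ₑ ^ 2))) x := by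
  by_cases hx : x ∈ outer n (R / 2)
  · rw [Set.indicator_of_mem hx]
    have hx0 : x ≠ 0 := ne_zero_of_mem_outer (half_pos hR) hx
    have hxp : 0 < ‖x‖ := norm_pos_iff.mpr hx0
    have h1 := fderiv_fun_smul
      ((contDiff_cutPower_norm (n := n) (β := b / 2) (T := T) hR).differentiable one_ne_zero x)
      (hv.differentiable one_ne_zero x)
    have h2 : ‖fderiv ℝ (fun y => cutPower (b / 2) R T ‖y‖ • v y) x‖ ≤
        ‖x‖ ^ (b / 2) * ‖fderiv ℝ v x‖ + L * ‖x‖ ^ (b / 2 - 1) * ‖v x‖ := by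
      rw [h1]
      refine (norm_add_le _ _).trans (add_le_add ?_ ?_)
      · rw [norm_smul, Real.norm_eq_abs]
        exact mul_le_mul_of_nonneg_right (abs_cutPower_le hxp.le) (norm_nonneg _)
      · rw [ContinuousLinearMap.norm_smulRight_apply]
        exact mul_le_mul_of_nonneg_right
          ((norm_fderiv_cutPower_norm_le hx0).trans (hL R T _ hxp)) (norm_nonneg _)
    have h3 : ‖fderiv ℝ (fun y => cutPower (b / 2) R T ‖y‖ • v y) x‖ ^ 2 ≤
        2 * (‖x‖ ^ b * ‖fderiv ℝ v x‖ ^ 2) + 2 * (L ^ 2 * (‖x‖ ^ (b - 2) * ‖v x‖ ^ 2)) := by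
      have e1 : ‖x‖ ^ b = (‖x‖ ^ (b / 2)) ^ 2 := by
        rw [← Real.rpow_natCast, ← Real.rpow_mul hxp.le]; congr 1; push_cast; ring
      have e2 : ‖x‖ ^ (b - 2) = (‖x‖ ^ (b / 2 - 1)) ^ 2 := by
        rw [← Real.rpow_natCast, ← Real.rpow_mul hxp.le]; congr 1; push_cast; ring
      rw [e1, e2]
      refine (pow_le_pow_left₀ (norm_nonneg _) h2 2).trans ?_
      nlinarith [sq_nonneg (‖x‖ ^ (b / 2) * ‖fderiv ℝ v x‖ - L * ‖x‖ ^ (b / 2 - 1) * ‖v x‖)]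
    have h4 := ENNReal.ofReal_le_ofReal h3
    rw [ENNReal.ofReal_add (by positivity) (by positivity), ENNReal.ofReal_mul (by positivity),
      ENNReal.ofReal_mul (by positivity), ENNReal.ofReal_mul (by positivity),
      ENNReal.ofReal_mul (by positivity), ENNReal.ofReal_mul (by positivity),
      ENNReal.ofReal_pow (norm_nonneg _), ENNReal.ofReal_pow (norm_nonneg _),
      ENNReal.ofReal_pow (norm_nonneg _), ofReal_norm, ofReal_norm, ofReal_norm,
      ENNReal.ofReal_ofNat] at h4
    exact h4
  · have hx' : ‖x‖ < R / 2 := not_le.mp hx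
    have : (fun y => cutPower (b / 2) R T ‖y‖ • v y) =ᶠ[𝓝 x] fun _ => 0 := by
      filter_upwards [eventually_cutPower_norm_eq_zero (β := b / 2) (T := T) hR hx'] with y hy
      simp only [hy, zero_smul]
    have h0 : fderiv ℝ (fun y => cutPower (b / 2) R T ‖y‖ • v y) x = 0 := by
      rw [this.fderiv_eq]
      exact fderiv_const_apply _
    rw [← ofReal_norm, h0, norm_zero, ENNReal.ofReal_zero, zero_pow two_ne_zero]
    exact zero_le

lemma setLIntegral_outer_le_of_forall {f : Rn n → ℝ≥0∞} {B : ℝ≥0∞} {R : ℝ}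
    (h : ∀ T : ℝ, 0 < T → ∫⁻ x in {x : Rn n | R ≤ ‖x‖ ∧ ‖x‖ ≤ T}, f x ≤ B) :
    ∫⁻ x in outer n R, f x ≤ B := by
  have hU : outer n R = ⋃ k : ℕ, {x : Rn n | R ≤ ‖x‖ ∧ ‖x‖ ≤ (k : ℝ) + 1} := by
    ext x
    simp only [Set.mem_iUnion]
    refine ⟨fun hx => ⟨⌈‖x‖⌉₊, hx, (Nat.le_ceil _).trans (by linarith)⟩, fun ⟨_, hx⟩ => hx.1⟩
  rw [hU, setLIntegral_iUnion_of_directed]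
  · exact iSup_le fun k => h _ (by positivity)
  · refine Monotone.directed_le fun j k hjk x hx => ⟨hx.1, hx.2.trans ?_⟩
    have : (j : ℝ) ≤ k := by exact_mod_cast hjk
    linarith

/-- A Caffarelli–Kohn–Nirenberg type inequality on `{|x| ≥ R}` for `C¹` functions. -/
lemma exists_sobolev_outer (hn : 3 ≤ n) (hb : 0 < n + b - 2) :
    ∃ C : ℝ≥0, ∀ R : ℝ, 0 < R → ∀ v : Rn n → ℂ, ContDiff ℝ 1 v →
      ∫⁻ x in outer n (R / 2), normWeight (b - 2) x * ‖v x‖ₑ ^ 2 ≠ ⊤ →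
      ∫⁻ x in outer n R, normWeight (b / 2 * (2 * n / (n - 2))) x * ‖v x‖ₑ ^ (2 * n / (n - 2) : ℝ) ≤
        (C * ∫⁻ x in outer n (R / 2), normWeight b x * ‖fderiv ℝ v x‖ₑ ^ 2) ^ (n / (n - 2) : ℝ) := by
  have hn3 : (3 : ℝ) ≤ n := by exact_mod_cast hn
  obtain ⟨CH, hCH⟩ := exists_hardy_outer hb
  obtain ⟨L, -, hL⟩ := exists_abs_deriv_cutPower_le (b / 2)
  set σ : ℝ := 2 * n / (n - 2) with hσ
  have hσ0 : 0 < σ := by rw [hσ]; apply div_pos <;> linarith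
  let q : ℝ≥0 := ⟨σ, hσ0.le⟩
  have hq0 : q ≠ 0 := fun h => hσ0.ne' (congrArg NNReal.toReal h)
  let CS : ℝ≥0 := SNormLESNormFDerivOfEqConst ℂ (volume : Measure (Rn n)) 2
  refine ⟨CS ^ 2 * (2 + 2 * ((L ^ 2).toNNReal * CH)), fun R hR v hv hfin => ?_⟩
  set D := ∫⁻ x in outer n (R / 2), normWeight b x * ‖fderiv ℝ v x‖ₑ ^ 2 with hD
  refine setLIntegral_outer_le_of_forall fun T hT => ?_
  -- The outer cut-off gives the compact support that the Sobolev inequality requires; `f` agrees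
  -- with `|x|^{b/2} v` on `R ≤ |x| ≤ T`.
  set f : Rn n → ℂ := fun y => cutPower (b / 2) R T ‖y‖ • v y with hf
  have hfd : ContDiff ℝ 1 f := (contDiff_cutPower_norm hR).smul hv
  have hfc : HasCompactSupport f := by
    refine HasCompactSupport.intro (isCompact_closedBall (0 : Rn n) (2 * T)) fun x hx => ?_
    have : 2 * T ≤ ‖x‖ := by
      simpa using (not_le.mp fun h => hx (mem_closedBall_zero_iff.mpr h)).le
    simp only [hf, cutPower_of_ge hT this, zero_smul]
  have hgns := eLpNorm_le_eLpNorm_fderiv_of_eq (volume : Measure (Rn n)) hfd hfc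
    (p := 2) (p' := q) (by norm_num) (by rw [finrank_euclideanSpace_fin]; omega) (by
      rw [finrank_euclideanSpace_fin]
      change σ⁻¹ = _
      rw [hσ]
      have : (n : ℝ) - 2 ≠ 0 := by linarith
      push_cast
      field_simp)
  have hgrad : eLpNorm (fderiv ℝ f) ((2 : ℝ≥0) : ℝ≥0∞) volume ^ (2 : ℝ) ≤
      (2 + 2 * ((L ^ 2).toNNReal * CH)) * D := by
    have h2 := eLpNorm_nnreal_pow_eq_lintegral (μ := (volume : Measure (Rn n)))
      (f := fderiv ℝ f) (p := 2) two_ne_zero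
    rw [NNReal.coe_ofNat] at h2
    rw [h2]
    calc ∫⁻ x, ‖fderiv ℝ f x‖ₑ ^ (2 : ℝ)
        ≤ ∫⁻ x, (outer n (R / 2)).indicator (fun x => 2 * (normWeight b x * ‖fderiv ℝ v x‖ₑ ^ 2) +
            2 * (ENNReal.ofReal (L ^ 2) * (normWeight (b - 2) x * ‖v x‖ₑ ^ 2))) x := by
          refine lintegral_mono fun x => ?_
          rw [ENNReal.rpow_two]
          exact enorm_fderiv_cutPower_smul_sq_le hL hR hv x
      _ = 2 * D + 2 * (ENNReal.ofReal (L ^ 2) *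
            ∫⁻ x in outer n (R / 2), normWeight (b - 2) x * ‖v x‖ₑ ^ 2) := by
          rw [lintegral_indicator (measurableSet_outer _), lintegral_add_left,
            lintegral_const_mul' _ _ (by norm_num), lintegral_const_mul' _ _ (by norm_num),
            lintegral_const_mul' _ _ ENNReal.ofReal_ne_top]
          refine ((measurable_normWeight b).mul
            ((hv.continuous_fderiv one_ne_zero).enorm.measurable.pow_const 2)).const_mul 2
      _ ≤ 2 * D + 2 * (ENNReal.ofReal (L ^ 2) * (CH * D)) := by
          gcongr
          exact hCH _ (half_pos hR) v hv hfin
      _ = _ := by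
          rw [ENNReal.ofReal]; ring
  calc ∫⁻ x in {x : Rn n | R ≤ ‖x‖ ∧ ‖x‖ ≤ T}, normWeight (b / 2 * σ) x * ‖v x‖ₑ ^ σ
      ≤ ∫⁻ x in {x : Rn n | R ≤ ‖x‖ ∧ ‖x‖ ≤ T}, ‖f x‖ₑ ^ σ := by
        refine setLIntegral_mono' ?_ fun x hx => ?_
        · exact (measurableSet_le measurable_const measurable_norm).inter (measurableSet_norm_le T)
        · rw [hf, ← normWeight_rpow _ hσ0.le, ← ENNReal.mul_rpow_of_nonneg _ _ hσ0.le]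
          refine ENNReal.rpow_le_rpow ?_ hσ0.le
          simp only
          rw [cutPower_of_mem hR hT hx.1 hx.2, enorm_smul, Real.enorm_eq_ofReal (by positivity)]
          exact le_rfl
    _ ≤ ∫⁻ x, ‖f x‖ₑ ^ σ := setLIntegral_le_lintegral _ _
    _ = eLpNorm f q volume ^ σ := (eLpNorm_nnreal_pow_eq_lintegral (p := q) hq0).symm
    _ ≤ (CS * eLpNorm (fderiv ℝ f) ((2 : ℝ≥0) : ℝ≥0∞) volume) ^ σ :=
        ENNReal.rpow_le_rpow hgns hσ0.le
    _ = (CS ^ 2 * eLpNorm (fderiv ℝ f) ((2 : ℝ≥0) : ℝ≥0∞) volume ^ (2 : ℝ)) ^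
          (n / (n - 2) : ℝ) := by
        rw [← ENNReal.rpow_two, ← ENNReal.mul_rpow_of_nonneg _ _ (by norm_num), ← ENNReal.rpow_mul,
          hσ, mul_div_assoc]
    _ ≤ _ := by
        refine ENNReal.rpow_le_rpow ?_ (div_nonneg (by linarith) (by linarith))
        refine (mul_le_mul_right hgrad _).trans_eq ?_
        push_cast
        ring

end Sobolev

/-! ### Mollification -/

section Mollify

variable {n : ℕ} {F : Type*} [NormedAddCommGroup F] [NormedSpace ℝ F]

/-- The mollification of `g` by a normalized bump function. -/
noncomputable def mollify (φ : ContDiffBump (0 : Rn n)) (g : Rn n → F) : Rn n → F :=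
  MeasureTheory.convolution (φ.normed volume) g (ContinuousLinearMap.lsmul ℝ ℝ) volume

variable (φ : ContDiffBump (0 : Rn n))

lemma mollify_apply (g : Rn n → F) (x : Rn n) :
    mollify φ g x = ∫ t, φ.normed volume t • g (x - t) := rfl

lemma mollify_apply_swap (g : Rn n → F) (x : Rn n) :
    mollify φ g x = ∫ t, φ.normed volume (x - t) • g t := by
  rw [mollify, convolution_eq_swap]
  rfl

lemma lintegral_ofReal_normed : ∫⁻ t, ENNReal.ofReal (φ.normed volume t) = 1 := by
  rw [← ofReal_integral_eq_lintegral_ofReal φ.integrable_normed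
    (ae_of_all _ φ.nonneg_normed), φ.integral_normed, ENNReal.ofReal_one]

lemma measurable_ofReal_normed : Measurable fun t => ENNReal.ofReal (φ.normed volume t) :=
  φ.continuous_normed.measurable.ennreal_ofReal

/-- Jensen's inequality for mollifications. -/
lemma enorm_mollify_sq_le {g : Rn n → F} (hg : AEStronglyMeasurable g volume) (x : Rn n) :
    ‖mollify φ g x‖ₑ ^ 2 ≤ ∫⁻ t, ENNReal.ofReal (φ.normed volume t) * ‖g (x - t)‖ₑ ^ 2 := by
  have h1 : ‖mollify φ g x‖ₑ ≤ ∫⁻ t, ENNReal.ofReal (φ.normed volume t) * ‖g (x - t)‖ₑ := by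
    rw [mollify_apply]
    refine (enorm_integral_le_lintegral_enorm _).trans_eq (lintegral_congr fun t => ?_)
    rw [enorm_smul, Real.enorm_eq_ofReal (φ.nonneg_normed t)]
  refine (pow_le_pow_left' h1 2).trans ((sq_lintegral_mul_le
    (measurable_ofReal_normed φ).aemeasurable
    (hg.comp_quasiMeasurePreserving (quasiMeasurePreserving_sub_left volume x)).enorm).trans_eq ?_)
  rw [lintegral_ofReal_normed, one_mul]
  rfl

/-- Jensen's inequality and Tonelli. A shift by at most `r / 2` changes `|x| ≥ r` by a factor at
most 2, which costs `2^|a|` in the weight and halves the inner radius. -/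
lemma setLIntegral_outer_mollify_le (a : ℝ) {r : ℝ} (hr : 0 < r) (hφ : φ.rOut ≤ r / 2)
    {g : Rn n → F} (hg : AEStronglyMeasurable g volume) :
    ∫⁻ x in outer n r, normWeight a x * ‖mollify φ g x‖ₑ ^ 2 ≤
      ENNReal.ofReal (2 ^ |a|) * ∫⁻ x in outer n (r / 2), normWeight a x * ‖g x‖ₑ ^ 2 := by
  set w : Rn n → ℝ≥0∞ := fun t => ENNReal.ofReal (φ.normed volume t) with hw
  have hwm : Measurable w := measurable_ofReal_normed φ
  set G : Rn n → ℝ≥0∞ := (outer n (r / 2)).indicator fun y => normWeight a y * ‖g y‖ₑ ^ 2 with hG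
  have hGm : AEMeasurable G volume :=
    ((measurable_normWeight a).aemeasurable.mul (hg.enorm.pow_const 2)).indicator
      (measurableSet_outer _)
  have hpt : ∀ x ∈ outer n r, ∀ t, normWeight a x * (w t * ‖g (x - t)‖ₑ ^ 2) ≤
      ENNReal.ofReal (2 ^ |a|) * (w t * G (x - t)) := by
    intro x hx t
    by_cases ht : φ.normed volume t = 0
    · simp [hw, ht]
    have htn : ‖t‖ < r / 2 := by
      have : t ∈ Function.support (φ.normed volume) := ht
      rw [φ.support_normed_eq, mem_ball_zero_iff] at this
      exact this.trans_le hφ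
    have hx' : r ≤ ‖x‖ := hx
    have h1 : ‖x‖ - ‖t‖ ≤ ‖x - t‖ := norm_sub_norm_le x t
    have h2 : ‖x - t‖ ≤ ‖x‖ + ‖t‖ := norm_sub_le x t
    have hmem : x - t ∈ outer n (r / 2) := by
      change r / 2 ≤ ‖x - t‖
      linarith
    rw [hG, Set.indicator_of_mem hmem]
    calc normWeight a x * (w t * ‖g (x - t)‖ₑ ^ 2)
        ≤ ENNReal.ofReal (2 ^ |a|) * normWeight a (x - t) * (w t * ‖g (x - t)‖ₑ ^ 2) := by
          gcongr
          exact normWeight_le_mul a (ne_zero_of_mem_outer hr hx)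
            (ne_zero_of_mem_outer (half_pos hr) hmem) (by linarith) (by linarith)
      _ = _ := by ring
  calc ∫⁻ x in outer n r, normWeight a x * ‖mollify φ g x‖ₑ ^ 2
      ≤ ∫⁻ x in outer n r, ENNReal.ofReal (2 ^ |a|) * ∫⁻ t, w t * G (x - t) := by
        refine setLIntegral_mono' (measurableSet_outer r) fun x hx => ?_
        rw [← lintegral_const_mul' _ _ ENNReal.ofReal_ne_top]
        refine (mul_le_mul_right (enorm_mollify_sq_le φ hg x) _).trans ?_
        rw [← lintegral_const_mul' _ _ (normWeight_ne_top a x)]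
        exact lintegral_mono (hpt x hx)
    _ ≤ ∫⁻ x, ENNReal.ofReal (2 ^ |a|) * ∫⁻ t, w t * G (x - t) := setLIntegral_le_lintegral _ _
    _ = ENNReal.ofReal (2 ^ |a|) * ∫⁻ t, ∫⁻ x, w t * G (x - t) := by
        rw [lintegral_const_mul' _ _ ENNReal.ofReal_ne_top, lintegral_lintegral_swap]
        refine AEMeasurable.mul (hwm.comp measurable_snd).aemeasurable ?_
        exact hGm.comp_quasiMeasurePreserving
          (quasiMeasurePreserving_sub_of_right_invariant volume volume)
    _ = ENNReal.ofReal (2 ^ |a|) * ∫⁻ t, w t * ∫⁻ x, G x := by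
        congr 1
        refine lintegral_congr fun t => ?_
        rw [lintegral_const_mul' _ _ ENNReal.ofReal_ne_top, lintegral_sub_right_eq_self G t]
    _ = _ := by
        rw [lintegral_mul_const _ hwm, lintegral_ofReal_normed, one_mul, hG,
          lintegral_indicator (measurableSet_outer _)]

variable {φ}

lemma contDiff_mollify [CompleteSpace F] {g : Rn n → F} (hg : LocallyIntegrable g volume) :
    ContDiff ℝ 1 (mollify φ g) :=
  φ.hasCompactSupport_normed.contDiff_convolution_left _ φ.contDiff_normed hg

lemma integrable_normed_sub_smul {g : Rn n → F} (hg : LocallyIntegrable g volume) (x : Rn n) :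
    Integrable fun t => φ.normed volume (x - t) • g t := by
  have h := (φ.hasCompactSupport_normed (μ := volume)).convolutionExists_left (ContinuousLinearMap.lsmul ℝ ℝ)
    φ.continuous_normed hg x
  exact h.integrable_swap

lemma fderiv_normed_sub_apply (x y e : Rn n) :
    fderiv ℝ (fun y => φ.normed volume (x - y)) y e = -fderiv ℝ (φ.normed volume) (x - y) e := by
  have hcd : ContDiff ℝ 1 (φ.normed volume) := φ.contDiff_normed
  have h1 : HasFDerivAt (fun y : Rn n => x - y) (-ContinuousLinearMap.id ℝ (Rn n)) y :=
    (hasFDerivAt_id (𝕜 := ℝ) y).const_sub x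
  have h2 := ((hcd.differentiable one_ne_zero (x - y)).hasFDerivAt.comp y h1).fderiv
  change fderiv ℝ (fun y => φ.normed volume (x - y)) y = _ at h2
  rw [h2, ContinuousLinearMap.comp_apply, neg_apply, ContinuousLinearMap.id_apply, map_neg]

lemma hasFDerivAt_mollify {u : Rn n → ℂ} (hu : LocallyIntegrable u volume) (x : Rn n) :
    HasFDerivAt (mollify φ u) (MeasureTheory.convolution (fderiv ℝ (φ.normed volume)) u
      ((ContinuousLinearMap.lsmul ℝ ℝ).precompL (Rn n)) volume x) x := by
  have hcd : ContDiff ℝ 1 (φ.normed volume) := φ.contDiff_normed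
  exact (φ.hasCompactSupport_normed (μ := volume)).hasFDerivAt_convolution_left
      (ContinuousLinearMap.lsmul ℝ ℝ) hcd hu x

lemma integrable_precompL_fderiv_normed {u : Rn n → ℂ} (hu : LocallyIntegrable u volume) (x : Rn n) :
    Integrable fun t => ((ContinuousLinearMap.lsmul ℝ ℝ).precompL (Rn n)
      (fderiv ℝ (φ.normed volume) (x - t))) (u t) := by
  have hcd : ContDiff ℝ 1 (φ.normed volume) := φ.contDiff_normed
  have := (((φ.hasCompactSupport_normed (μ := volume)).fderiv ℝ).convolutionExists_left
      ((ContinuousLinearMap.lsmul ℝ ℝ).precompL (Rn n)) (hcd.continuous_fderiv one_ne_zero)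
      hu x)
  exact this.integrable_swap

lemma fderiv_mollify_apply {u : Rn n → ℂ} (hu : LocallyIntegrable u volume) (x e : Rn n) :
    fderiv ℝ (mollify φ u) x e = ∫ y, fderiv ℝ (φ.normed volume) (x - y) e • u y := by
  rw [(hasFDerivAt_mollify hu x).fderiv, convolution_eq_swap]
  rw [ContinuousLinearMap.integral_apply (integrable_precompL_fderiv_normed hu x)]
  refine integral_congr_ae (ae_of_all _ fun t => ?_)
  simp only [ContinuousLinearMap.precompL_apply, ContinuousLinearMap.lsmul_apply]

lemma mollify_apply_coord {g : Rn n → EuclideanSpace ℂ (Fin n)}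
    (hg : LocallyIntegrable g volume) (x : Rn n) (i : Fin n) :
    mollify φ g x i = ∫ y, φ.normed volume (x - y) • g y i := by
  rw [mollify_apply_swap]
  exact ((EuclideanSpace.proj (𝕜 := ℂ) i).integral_comp_comm
    (integrable_normed_sub_smul hg x)).symm

/-- Mollification commutes with weak differentiation. -/
lemma fderiv_mollify_single {u : Rn n → ℂ} {g : Rn n → EuclideanSpace ℂ (Fin n)}
    (hug : IsWeakGradient u g) (x : Rn n) (i : Fin n) :
    fderiv ℝ (mollify φ u) x (EuclideanSpace.single i 1) = mollify φ g x i := by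
  have hψ : ContDiff ℝ ∞ fun y => φ.normed volume (x - y) :=
    φ.contDiff_normed.comp (contDiff_const.sub contDiff_id)
  have hψc : HasCompactSupport fun y => φ.normed volume (x - y) :=
    φ.hasCompactSupport_normed.comp_homeomorph (Homeomorph.subLeft x)
  have h := hug.integral_eq _ hψ hψc i
  simp only [fderiv_normed_sub_apply, neg_smul, integral_neg, neg_inj] at h
  rw [fderiv_mollify_apply hug.locallyIntegrable, h,
    mollify_apply_coord hug.locallyIntegrable_grad]

/-- Cauchy–Schwarz in coordinates; it passes from the operator norm of the Fréchet derivative to the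
Euclidean norm of the gradient vector. -/
lemma norm_clm_le_of_apply_single {L : Rn n →L[ℝ] ℂ} {G : EuclideanSpace ℂ (Fin n)}
    (h : ∀ i, L (EuclideanSpace.single i 1) = G i) : ‖L‖ ≤ ‖G‖ := by
  refine L.opNorm_le_bound (norm_nonneg _) fun y => ?_
  have hy : y = ∑ i, y i • EuclideanSpace.single i (1 : ℝ) := by
    ext j
    simp [Finset.sum_apply, Pi.single_apply]
  have hL : L y = ∑ i, y i • G i := by
    conv_lhs => rw [hy]
    simp [map_sum, h]
  rw [hL, mul_comm, EuclideanSpace.norm_eq, EuclideanSpace.norm_eq]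
  refine (norm_sum_le _ _).trans ?_
  simp only [norm_smul]
  exact Real.sum_mul_le_sqrt_mul_sqrt _ _ _

lemma enorm_fderiv_mollify_le {u : Rn n → ℂ} {g : Rn n → EuclideanSpace ℂ (Fin n)}
    (hug : IsWeakGradient u g) (x : Rn n) :
    ‖fderiv ℝ (mollify φ u) x‖ₑ ≤ ‖mollify φ g x‖ₑ := by
  rw [← ofReal_norm, ← ofReal_norm]
  exact ENNReal.ofReal_le_ofReal
    (norm_clm_le_of_apply_single fun i => fderiv_mollify_single hug x i)

end Mollify

/-- The Caffarelli–Kohn–Nirenberg type inequality on `{|x| ≥ R}` for weakly differentiable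
functions. -/
lemma exists_weak_sobolev_outer {n : ℕ} {b : ℝ} (hn : 3 ≤ n) (hb : 0 < n + b - 2) :
    ∃ C : ℝ≥0, ∀ R : ℝ, 0 < R → ∀ (u : Rn n → ℂ) (g : Rn n → EuclideanSpace ℂ (Fin n)),
      IsWeakGradient u g →
      ∫⁻ x in outer n R, normWeight (b - 2) x * ‖u x‖ₑ ^ 2 ≠ ⊤ →
      ∫⁻ x in outer n R, normWeight (b / 2 * (2 * n / (n - 2))) x * ‖u x‖ₑ ^ (2 * n / (n - 2) : ℝ) ≤
        (C * ∫⁻ x, normWeight b x * ‖g x‖ₑ ^ 2) ^ (n / (n - 2) : ℝ) := by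
  have hn3 : (3 : ℝ) ≤ n := by exact_mod_cast hn
  obtain ⟨C, hC⟩ := exists_sobolev_outer hn hb
  refine ⟨C * (2 ^ |b| : ℝ).toNNReal, fun R hR u g hug hfin => ?_⟩
  have hum := hug.locallyIntegrable.aestronglyMeasurable
  have hgm := hug.locallyIntegrable_grad.aestronglyMeasurable
  set σ : ℝ := 2 * n / (n - 2) with hσ
  -- Radii at most `R / 4` allow the mollification estimate on `{|x| ≥ R / 2}`; the fixed ratio
  -- `rOut = 2 rIn` gives almost everywhere convergence of the mollifications.
  let φ : ℕ → ContDiffBump (0 : Rn n) := fun k =>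
    { rIn := R / 8 / (k + 1)
      rOut := R / 4 / (k + 1)
      rIn_pos := by positivity
      rIn_lt_rOut := by gcongr; norm_num }
  have hφ4 : ∀ k, (φ k).rOut ≤ R / 4 := fun k =>
    div_le_self (by positivity) (by linarith [(Nat.cast_nonneg k : (0 : ℝ) ≤ k)])
  have hφ0 : Tendsto (fun k => (φ k).rOut) atTop (𝓝 0) := by
    have := (tendsto_one_div_add_atTop_nhds_zero_nat (𝕜 := ℝ)).const_mul (R / 4)
    simpa [φ, div_eq_mul_inv] using this
  have hae := ContDiffBump.ae_convolution_tendsto_right_of_locallyIntegrable (K := 2) hφ0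
    (Eventually.of_forall fun k => by
      change R / 4 / ((k : ℝ) + 1) ≤ 2 * (R / 8 / (k + 1))
      apply le_of_eq; ring) hug.locallyIntegrable
  have hbound : ∀ k, ∫⁻ x in outer n R, normWeight (b / 2 * σ) x * ‖mollify (φ k) u x‖ₑ ^ σ ≤
      ((C * (2 ^ |b| : ℝ).toNNReal : ℝ≥0) * ∫⁻ x, normWeight b x * ‖g x‖ₑ ^ 2) ^
        (n / (n - 2) : ℝ) := by
    intro k
    have hcd : ContDiff ℝ 1 (mollify (φ k) u) := contDiff_mollify hug.locallyIntegrable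
    refine (hC R hR _ hcd ?_).trans ?_
    -- Finiteness is known for `u` on `{|x| ≥ R}` but is needed for its mollification on `{|x| ≥ R /
    -- 2}`. Beyond `2R` it is inherited from `u`; on the remaining compact annulus the mollification
    -- is continuous.
    · have hsub : outer n (R / 2) ⊆ outer n (2 * R) ∪ {x | R / 2 ≤ ‖x‖ ∧ ‖x‖ ≤ 2 * R} :=
        fun x hx => (le_total (2 * R) ‖x‖).imp id fun h => ⟨hx, h⟩
      refine ne_top_of_le_ne_top ?_ ((lintegral_mono_set hsub).trans (lintegral_union_le _ _ _))
      refine ENNReal.add_ne_top.mpr ⟨?_, ?_⟩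
      · refine ne_top_of_le_ne_top ?_ (setLIntegral_outer_mollify_le (φ k) (b - 2)
          (r := 2 * R) (by positivity) ((hφ4 k).trans (by linarith)) hum)
        rw [mul_div_cancel_left₀ _ two_ne_zero]
        exact ENNReal.mul_ne_top ENNReal.ofReal_ne_top hfin
      · have hK : IsCompact {x : Rn n | R / 2 ≤ ‖x‖ ∧ ‖x‖ ≤ 2 * R} := by
          have : {x : Rn n | R / 2 ≤ ‖x‖ ∧ ‖x‖ ≤ 2 * R} =
              Metric.closedBall 0 (2 * R) ∩ {x | R / 2 ≤ ‖x‖} := by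
            ext x; simp [and_comm]
          rw [this]
          exact (isCompact_closedBall _ _).inter_right
            (isClosed_le continuous_const continuous_norm)
        have hcont : ContinuousOn (fun x => ‖x‖ ^ (b - 2) * ‖mollify (φ k) u x‖ ^ 2)
            {x : Rn n | R / 2 ≤ ‖x‖ ∧ ‖x‖ ≤ 2 * R} := by
          refine ContinuousOn.mul (continuous_norm.continuousOn.rpow_const fun x hx => Or.inl ?_)
            (hcd.continuous.norm.pow 2).continuousOn
          exact ((half_pos hR).trans_le hx.1).ne'
        have hint := (hcont.integrableOn_compact (μ := volume) hK).hasFiniteIntegral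
        refine ne_of_lt (lt_of_eq_of_lt (lintegral_congr fun x => ?_) hint)
        rw [enorm_mul, enorm_pow, enorm_norm, Real.enorm_eq_ofReal (by positivity)]
        rfl
    · refine ENNReal.rpow_le_rpow ?_ (div_nonneg (by linarith) (by linarith))
      push_cast
      rw [mul_assoc]
      refine mul_le_mul_right ?_ _
      calc ∫⁻ x in outer n (R / 2), normWeight b x * ‖fderiv ℝ (mollify (φ k) u) x‖ₑ ^ 2
          ≤ ∫⁻ x in outer n (R / 2), normWeight b x * ‖mollify (φ k) g x‖ₑ ^ 2 := by
            gcongr with x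
            exact enorm_fderiv_mollify_le hug x
        _ ≤ ENNReal.ofReal (2 ^ |b|) *
              ∫⁻ x in outer n (R / 2 / 2), normWeight b x * ‖g x‖ₑ ^ 2 :=
            setLIntegral_outer_mollify_le (φ k) b (half_pos hR) ((hφ4 k).trans (by linarith)) hgm
        _ ≤ _ := by
            gcongr
            · exact le_rfl
            · exact Measure.restrict_le_self
  calc ∫⁻ x in outer n R, normWeight (b / 2 * σ) x * ‖u x‖ₑ ^ σ
      = ∫⁻ x in outer n R, liminf (fun k => normWeight (b / 2 * σ) x *
          ‖mollify (φ k) u x‖ₑ ^ σ) atTop := by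
        refine lintegral_congr_ae (ae_restrict_of_ae ?_)
        filter_upwards [hae] with x hx
        refine (Tendsto.liminf_eq ?_).symm
        refine ENNReal.Tendsto.const_mul ?_ (Or.inr (normWeight_ne_top _ _))
        exact (ENNReal.continuous_rpow_const.tendsto _).comp
          ((continuous_enorm.tendsto (u x)).comp hx)
    -- Fatou's lemma: only almost everywhere convergence and the uniform bound `hbound` are needed.
    _ ≤ liminf (fun k => ∫⁻ x in outer n R, normWeight (b / 2 * σ) x *
          ‖mollify (φ k) u x‖ₑ ^ σ) atTop :=
        lintegral_liminf_le fun k => (measurable_normWeight _).mul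
          ((contDiff_mollify hug.locallyIntegrable).continuous.enorm.measurable.pow_const σ)
    _ ≤ _ := liminf_le_of_le (by isBoundedDefault) fun c hc => by
        obtain ⟨k, hk⟩ := hc.exists
        exact hk.trans (hbound k)

/-! ### Dyadic decomposition of exterior domains -/

section Dyadic

variable {n : ℕ}

/-- The annulus `{r ≤ |x| ≤ 2 r}`. -/
def annulus (n : ℕ) (r : ℝ) : Set (Rn n) := {x | r ≤ ‖x‖ ∧ ‖x‖ ≤ 2 * r}

lemma measurableSet_annulus (r : ℝ) : MeasurableSet (annulus n r) :=
  (measurableSet_outer r).inter (measurableSet_norm_le _)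

lemma annulus_subset_outer {R r : ℝ} (h : R ≤ r) : annulus n r ⊆ outer n R :=
  fun _ hx => h.trans hx.1

lemma outer_subset_iUnion_annulus {R : ℝ} (hR : 0 < R) :
    outer n R ⊆ ⋃ j : ℕ, annulus n (2 ^ j * R) := by
  intro x hx
  obtain ⟨j, hj₁, hj₂⟩ := exists_nat_pow_near (x := ‖x‖ / R) (y := 2)
    ((one_le_div hR).mpr hx) one_lt_two
  refine Set.mem_iUnion.mpr ⟨j, (le_div_iff₀ hR).mp hj₁, ?_⟩
  have := ((div_lt_iff₀ hR).mp hj₂).le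
  rw [pow_succ] at this
  linarith

lemma setLIntegral_outer_le_tsum {R : ℝ} (hR : 0 < R) (f : Rn n → ℝ≥0∞) :
    ∫⁻ x in outer n R, f x ≤ ∑' j : ℕ, ∫⁻ x in annulus n (2 ^ j * R), f x :=
  (lintegral_mono_set (outer_subset_iUnion_annulus hR)).trans (lintegral_iUnion_le _ _)

lemma normWeight_le_of_mem_annulus (a : ℝ) {r : ℝ} (hr : 0 < r) {x : Rn n}
    (hx : x ∈ annulus n r) :
    normWeight a x ≤ ENNReal.ofReal (2 ^ |a|) * ENNReal.ofReal (r ^ a) := by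
  rw [normWeight, ← ENNReal.ofReal_mul (by positivity)]
  exact ENNReal.ofReal_le_ofReal (rpow_le_two_rpow_abs_mul a (hr.trans_le hx.1) hr hx.2
    (by linarith [hx.1]))

lemma setLIntegral_annulus_le_rho (s : ℝ) (u : Rn n → ℂ) {R r : ℝ} (hr : 0 < r) (h : R ≤ r) :
    ∫⁻ x in annulus n r, ‖u x‖ₑ ^ 2 ≤ rho s u R * ENNReal.ofReal (r ^ (2 * s)) := by
  have h1 : (∫⁻ x in annulus n r, ‖u x‖ₑ ^ 2) / ENNReal.ofReal (r ^ (2 * s)) ≤ rho s u R :=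
    le_iSup₂ (f := fun (R' : ℝ) (_ : R ≤ R') =>
      (∫⁻ x in {x : Rn n | R' ≤ ‖x‖ ∧ ‖x‖ ≤ 2 * R'}, ‖u x‖ₑ ^ 2) /
        ENNReal.ofReal (R' ^ (2 * s))) r h
  exact (ENNReal.div_le_iff (ENNReal.ofReal_pos.mpr (by positivity)).ne'
    ENNReal.ofReal_ne_top).mp h1

/-- The sum `∑ 2^{-κ j}`. -/
noncomputable def dyadicSum (κ : ℝ) : ℝ≥0∞ := ∑' j : ℕ, ENNReal.ofReal (2 ^ (-κ)) ^ j

lemma dyadicSum_ne_top {κ : ℝ} (hκ : 0 < κ) : dyadicSum κ ≠ ⊤ := by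
  rw [dyadicSum, ENNReal.tsum_geometric]
  refine ENNReal.inv_ne_top.mpr (tsub_pos_of_lt ?_).ne'
  rw [ENNReal.ofReal_lt_one]
  exact Real.rpow_lt_one_of_one_lt_of_neg one_lt_two (by linarith)

lemma tsum_dyadic_rpow {κ R : ℝ} (hR : 0 < R) :
    ∑' j : ℕ, ENNReal.ofReal ((2 ^ j * R) ^ (-κ)) = dyadicSum κ * ENNReal.ofReal (R ^ (-κ)) := by
  rw [dyadicSum, ← ENNReal.tsum_mul_right]
  refine tsum_congr fun j => ?_
  rw [← ENNReal.ofReal_pow (by positivity), ← ENNReal.ofReal_mul (by positivity),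
    Real.mul_rpow (by positivity) hR.le, ← Real.rpow_natCast, ← Real.rpow_natCast,
    ← Real.rpow_mul (by norm_num), ← Real.rpow_mul (by norm_num), mul_comm (j : ℝ)]

lemma two_pow_mul_pos {R : ℝ} (hR : 0 < R) (j : ℕ) : 0 < 2 ^ j * R := by positivity

lemma le_two_pow_mul {R : ℝ} (hR : 0 < R) (j : ℕ) : R ≤ 2 ^ j * R :=
  le_mul_of_one_le_left hR.le (one_le_pow₀ one_le_two)

/-- On the annulus of radius `r` the integral is at most a multiple of `ρ r^{a+2s}`, which is
summable over dyadic `r`. With `a = b - 2` this supplies the finiteness required for the Hardy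
absorption. -/
lemma setLIntegral_outer_normWeight_mul_sq_ne_top {a s : ℝ} (has : a + 2 * s < 0) {R : ℝ}
    (hR : 0 < R) {u : Rn n → ℂ} (hρ : rho s u R ≠ ⊤) :
    ∫⁻ x in outer n R, normWeight a x * ‖u x‖ₑ ^ 2 ≠ ⊤ := by
  have key : ∀ j : ℕ, ∫⁻ x in annulus n (2 ^ j * R), normWeight a x * ‖u x‖ₑ ^ 2 ≤
      ENNReal.ofReal (2 ^ |a|) * rho s u R *
        ENNReal.ofReal ((2 ^ j * R) ^ (-(-(a + 2 * s)))) := by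
    intro j
    have hr := two_pow_mul_pos hR j
    set r := 2 ^ j * R
    calc ∫⁻ x in annulus n r, normWeight a x * ‖u x‖ₑ ^ 2
        ≤ ∫⁻ x in annulus n r, ENNReal.ofReal (2 ^ |a|) * ENNReal.ofReal (r ^ a) * ‖u x‖ₑ ^ 2 := by
          refine setLIntegral_mono' (measurableSet_annulus _) fun x hx => ?_
          gcongr
          exact normWeight_le_of_mem_annulus a hr hx
      _ = ENNReal.ofReal (2 ^ |a|) * ENNReal.ofReal (r ^ a) *
            ∫⁻ x in annulus n r, ‖u x‖ₑ ^ 2 :=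
          lintegral_const_mul' _ _ (ENNReal.mul_ne_top ENNReal.ofReal_ne_top ENNReal.ofReal_ne_top)
      _ ≤ ENNReal.ofReal (2 ^ |a|) * ENNReal.ofReal (r ^ a) *
            (rho s u R * ENNReal.ofReal (r ^ (2 * s))) := by
          gcongr
          exact setLIntegral_annulus_le_rho s u hr (le_two_pow_mul hR j)
      _ = ENNReal.ofReal (2 ^ |a|) * rho s u R *
            (ENNReal.ofReal (r ^ a) * ENNReal.ofReal (r ^ (2 * s))) := by ring
      _ = _ := by
          rw [← ENNReal.ofReal_mul (by positivity), ← Real.rpow_add hr, neg_neg]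
  refine ne_top_of_le_ne_top ?_ ((setLIntegral_outer_le_tsum hR _).trans (ENNReal.tsum_le_tsum key))
  rw [ENNReal.tsum_mul_left, tsum_dyadic_rpow hR]
  exact ENNReal.mul_ne_top (ENNReal.mul_ne_top ENNReal.ofReal_ne_top hρ)
    (ENNReal.mul_ne_top (dyadicSum_ne_top (by linarith)) ENNReal.ofReal_ne_top)

/-- Interpolation between `L²` and `L^σ` on dyadic annuli, summed over the exterior domain. -/
lemma setLIntegral_outer_interpolation_le {c d p s t σ κ : ℝ} (ht₀ : 0 ≤ t) (ht₁ : t ≤ 1)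
    (hσ : 0 ≤ σ) (hp : p = t * σ + 2 * (1 - t)) (hκ : c - d * t + 2 * s * (1 - t) = -κ) {R : ℝ}
    (hR : 0 < R) {u : Rn n → ℂ} (hu : AEStronglyMeasurable u volume) :
    ∫⁻ x in outer n R, normWeight c x * ‖u x‖ₑ ^ p ≤
      ENNReal.ofReal (2 ^ |c - d * t|) * dyadicSum κ * ENNReal.ofReal (R ^ (-κ)) *
        ((∫⁻ x in outer n R, normWeight d x * ‖u x‖ₑ ^ σ) ^ t * rho s u R ^ (1 - t)) := by
  have ht₁' : 0 ≤ 1 - t := sub_nonneg.mpr ht₁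
  set Z := ∫⁻ x in outer n R, normWeight d x * ‖u x‖ₑ ^ σ with hZ
  set δ := c - d * t with hδ
  -- Hölder with exponents `t` and `1 - t`; the excess weight `|x|^δ` is comparable to `r^δ` on the
  -- annulus and combines with `r^{2s(1-t)}` from `ρ` into `r^{-κ}`. The Sobolev factor may be
  -- enlarged to all of `{|x| ≥ R}`, since `r^{-κ}` alone carries the decay in `j`.
  have key : ∀ j : ℕ, ∫⁻ x in annulus n (2 ^ j * R), normWeight c x * ‖u x‖ₑ ^ p ≤
      ENNReal.ofReal (2 ^ |δ|) * (Z ^ t * rho s u R ^ (1 - t)) *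
        ENNReal.ofReal ((2 ^ j * R) ^ (-κ)) := by
    intro j
    have hr := two_pow_mul_pos hR j
    have hRr := le_two_pow_mul hR j
    set r := 2 ^ j * R
    calc ∫⁻ x in annulus n r, normWeight c x * ‖u x‖ₑ ^ p
        ≤ ∫⁻ x in annulus n r, ENNReal.ofReal (2 ^ |δ|) * ENNReal.ofReal (r ^ δ) *
            ((normWeight d x * ‖u x‖ₑ ^ σ) ^ t * (‖u x‖ₑ ^ (2 : ℝ)) ^ (1 - t)) := by
          refine setLIntegral_mono' (measurableSet_annulus _) fun x hx => ?_
          have hx0 : x ≠ 0 := ne_zero_of_mem_outer hr hx.1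
          have e : normWeight c x * ‖u x‖ₑ ^ p = normWeight δ x *
              ((normWeight d x * ‖u x‖ₑ ^ σ) ^ t * (‖u x‖ₑ ^ (2 : ℝ)) ^ (1 - t)) := by
            rw [ENNReal.mul_rpow_of_nonneg _ _ ht₀, normWeight_rpow _ ht₀, ← ENNReal.rpow_mul,
              ← ENNReal.rpow_mul, mul_assoc,
              ← ENNReal.rpow_add_of_nonneg _ _ (by positivity) (by positivity), ← mul_assoc,
              normWeight_mul _ _ hx0, hp, hδ, sub_add_cancel, mul_comm σ t]
          rw [e]
          gcongr
          exact normWeight_le_of_mem_annulus δ hr hx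
      _ = ENNReal.ofReal (2 ^ |δ|) * ENNReal.ofReal (r ^ δ) *
            ∫⁻ x in annulus n r,
              (normWeight d x * ‖u x‖ₑ ^ σ) ^ t * (‖u x‖ₑ ^ (2 : ℝ)) ^ (1 - t) :=
          lintegral_const_mul' _ _ (ENNReal.mul_ne_top ENNReal.ofReal_ne_top ENNReal.ofReal_ne_top)
      _ ≤ ENNReal.ofReal (2 ^ |δ|) * ENNReal.ofReal (r ^ δ) *
            ((∫⁻ x in annulus n r, normWeight d x * ‖u x‖ₑ ^ σ) ^ t *
              (∫⁻ x in annulus n r, ‖u x‖ₑ ^ (2 : ℝ)) ^ (1 - t)) := by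
          refine mul_le_mul_right (ENNReal.lintegral_mul_norm_pow_le ?_
            (hu.restrict.enorm.pow_const 2) ht₀ ht₁' (by ring)) _
          exact (measurable_normWeight d).aemeasurable.mul (hu.restrict.enorm.pow_const σ)
      _ ≤ ENNReal.ofReal (2 ^ |δ|) * ENNReal.ofReal (r ^ δ) *
            (Z ^ t * (rho s u R * ENNReal.ofReal (r ^ (2 * s))) ^ (1 - t)) := by
          refine mul_le_mul_right (mul_le_mul' (ENNReal.rpow_le_rpow ?_ ht₀)
            (ENNReal.rpow_le_rpow ?_ ht₁')) _
          · exact lintegral_mono_set (annulus_subset_outer hRr)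
          · simp only [ENNReal.rpow_two]
            exact setLIntegral_annulus_le_rho s u hr hRr
      _ = ENNReal.ofReal (2 ^ |δ|) * (Z ^ t * rho s u R ^ (1 - t)) *
            (ENNReal.ofReal (r ^ δ) * ENNReal.ofReal (r ^ (2 * s)) ^ (1 - t)) := by
          rw [ENNReal.mul_rpow_of_nonneg _ _ ht₁']; ring
      _ = _ := by
          rw [ENNReal.ofReal_rpow_of_nonneg (by positivity) ht₁', ← Real.rpow_mul hr.le,
            ← ENNReal.ofReal_mul (by positivity), ← Real.rpow_add hr, hκ]
  refine (setLIntegral_outer_le_tsum hR _).trans ((ENNReal.tsum_le_tsum key).trans_eq ?_)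
  rw [ENNReal.tsum_mul_left, tsum_dyadic_rpow hR]
  ring

end Dyadic

/-- Young's inequality with a small constant. -/
lemma exists_young {θ : ℝ} (hθ₀ : 0 ≤ θ) (hθ₁ : θ < 1) (K : ℝ≥0) {η : ℝ≥0} (hη : 0 < η) :
    ∃ C : ℝ≥0, 0 < C ∧ ∀ A B : ℝ≥0∞, K * (A ^ θ * B ^ (1 - θ)) ≤ η * A + C * B := by
  have hθ : 0 < 1 - θ := sub_pos.mpr hθ₁
  -- Chosen so that `K δ^{1-θ} ≤ η`. If `B ≤ δA` the product is at most `ηA`; otherwise `A ≤ B/δ`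
  -- and it is at most a multiple of `B`. This dichotomy needs no separate treatment of infinite
  -- values.
  set δ : ℝ≥0 := (η / (K + 1)) ^ (1 / (1 - θ)) with hδ
  have hδ0 : 0 < δ := NNReal.rpow_pos (by positivity)
  have hδ1 : K * δ ^ (1 - θ) ≤ η := by
    rw [hδ, ← NNReal.rpow_mul, one_div_mul_cancel hθ.ne', NNReal.rpow_one, mul_div_left_comm]
    refine mul_le_of_le_one_right' ?_
    rw [div_le_one (by positivity)]
    exact le_self_add
  have hsplit : ∀ A : ℝ≥0∞, A ^ θ * A ^ (1 - θ) = A := fun A => by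
    rw [← ENNReal.rpow_add_of_nonneg _ _ hθ₀ hθ.le, add_sub_cancel, ENNReal.rpow_one]
  refine ⟨K * (δ⁻¹) ^ θ + 1, by positivity, fun A B => ?_⟩
  rcases le_total B (δ * A) with h | h
  · refine le_add_right ?_
    calc (K : ℝ≥0∞) * (A ^ θ * B ^ (1 - θ)) ≤ K * (A ^ θ * (δ * A) ^ (1 - θ)) := by gcongr
      _ = (K * δ ^ (1 - θ) : ℝ≥0) * (A ^ θ * A ^ (1 - θ)) := by
          rw [ENNReal.mul_rpow_of_nonneg _ _ hθ.le, ENNReal.coe_mul,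
            ENNReal.coe_rpow_of_nonneg _ hθ.le]
          ring
      _ ≤ η * A := by
          rw [hsplit]
          gcongr
  · refine le_add_left ?_
    have hA : A ≤ (δ⁻¹ : ℝ≥0) * B := by
      rw [ENNReal.coe_inv hδ0.ne', mul_comm, ← div_eq_mul_inv]
      exact (ENNReal.le_div_iff_mul_le (Or.inl (by exact_mod_cast hδ0.ne'))
        (Or.inl ENNReal.coe_ne_top)).mpr (by rwa [mul_comm])
    calc (K : ℝ≥0∞) * (A ^ θ * B ^ (1 - θ)) ≤ K * (((δ⁻¹ : ℝ≥0) * B) ^ θ * B ^ (1 - θ)) := by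
          gcongr
      _ = (K * (δ⁻¹) ^ θ : ℝ≥0) * (B ^ θ * B ^ (1 - θ)) := by
          rw [ENNReal.mul_rpow_of_nonneg _ _ hθ₀, ENNReal.coe_mul,
            ENNReal.coe_rpow_of_nonneg _ hθ₀]
          ring
      _ ≤ _ := by
          rw [hsplit]
          gcongr
          exact le_self_add

/-- The exterior estimate for the potential energy, with a scaling parameter `s`. -/
lemma exists_outer_potential_le {n : ℕ} {b c p s : ℝ} (hn : 3 ≤ n) (hb : 2 - (n : ℝ) < b)
    (hp₀ : 0 < p) (hp₁ : n * p < 4) (hs : 2 * s < 2 - b) (hsp : s * p = n * p / 2 - (2 - b + c))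
    {η : ℝ≥0} (hη : 0 < η) :
    ∃ Cη : ℝ≥0, 0 < Cη ∧ ∀ (u : Rn n → ℂ) (g : Rn n → EuclideanSpace ℂ (Fin n)),
      IsWeakGradient u g → ∀ R : ℝ, 0 < R →
        ∫⁻ x in outer n R, normWeight c x * ‖u x‖ₑ ^ (p + 2) ≤
          η * (∫⁻ x, normWeight b x * ‖g x‖ₑ ^ 2) +
            Cη / ENNReal.ofReal (R ^ (2 - b - 2 * s)) *
              rho s u R ^ ((4 - n * p + 2 * p) / (4 - n * p)) := by
  have hn3 : (3 : ℝ) ≤ n := by exact_mod_cast hn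
  have hn2 : 0 < (n : ℝ) - 2 := by linarith
  obtain ⟨C, hC⟩ := exists_weak_sobolev_outer (b := b) hn (by linarith)
  -- `t` solves `p + 2 = tσ + 2(1 - t)` for the Sobolev exponent `σ = 2n/(n-2)`; `θ = t n/(n-2)` is
  -- the resulting power of the gradient integral.
  set t : ℝ := p * (n - 2) / 4 with ht
  set θ : ℝ := n * p / 4 with hθ
  have ht₀ : 0 ≤ t := by positivity
  have hθ₀ : 0 ≤ θ := by positivity
  have hθ₁ : θ < 1 := by rw [hθ]; linarith
  have ht₁ : t ≤ 1 := by rw [ht]; nlinarith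
  have hθt : n / (n - 2) * t = θ := by rw [ht, hθ]; field_simp
  set σ : ℝ := 2 * n / (n - 2) with hσ
  have hσt : t * σ = 2 * θ := by rw [hσ, ← hθt]; ring
  set κ : ℝ := (2 - b - 2 * s) * (1 - θ) with hκ
  have hκ0 : 0 < κ := mul_pos (by linarith) (by linarith)
  -- `μ = (1 - t)/(1 - θ)` and `κ/(1 - θ) = 2 - b - 2s` are the powers of `ρ` and of `1/R` left
  -- after Young's inequality.
  set μ : ℝ := (4 - n * p + 2 * p) / (4 - n * p) with hμ
  have hμt : 1 - t = μ * (1 - θ) := by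
    have : 4 - n * p ≠ 0 := by linarith
    have h1 : 1 - θ = (4 - n * p) / 4 := by rw [hθ]; ring
    rw [hμ, ht, h1, div_mul_div_cancel₀ this]
    ring
  have hμ0 : 0 < μ := by rw [hμ]; apply div_pos <;> linarith
  -- Since `θ - t = p/2`, this balance of powers is equivalent to the scaling identity `hsp`.
  have hexp : c - b / 2 * σ * t + 2 * s * (1 - t) = -κ := by
    have h1 : b / 2 * σ * t = b * θ := by rw [mul_assoc, mul_comm σ, hσt]; ring
    rw [h1, hκ, ht, hθ]
    linarith
  have hpt : p + 2 = t * σ + 2 * (1 - t) := by rw [hσt, hθ, ht]; ring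
  set K : ℝ≥0∞ := ENNReal.ofReal (2 ^ |c - b / 2 * σ * t|) * dyadicSum κ * (C : ℝ≥0∞) ^ θ with hK
  have hKtop : K ≠ ⊤ := ENNReal.mul_ne_top
    (ENNReal.mul_ne_top ENNReal.ofReal_ne_top (dyadicSum_ne_top hκ0))
    (ENNReal.rpow_ne_top_of_nonneg hθ₀ ENNReal.coe_ne_top)
  obtain ⟨Cη, hCη, hY⟩ := exists_young hθ₀ hθ₁ K.toNNReal hη
  refine ⟨Cη, hCη, fun u g hug R hR => ?_⟩
  have hRpos : 0 < R ^ (2 - b - 2 * s) := by positivity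
  -- For infinite `ρ` the right-hand side is infinite, because `Cη > 0` and `μ > 0`; this is why
  -- Young's constant is taken positive.
  by_cases hρ : rho s u R = ⊤
  · rw [hρ, ENNReal.top_rpow_of_pos hμ0, ENNReal.mul_top, add_top]
    · exact le_top
    · exact (ENNReal.div_pos (by exact_mod_cast hCη.ne') ENNReal.ofReal_ne_top).ne'
  have hfin := setLIntegral_outer_normWeight_mul_sq_ne_top (a := b - 2) (by linarith) hR hρ
  have hZ := hC R hR u g hug hfin
  set X := ∫⁻ x, normWeight b x * ‖g x‖ₑ ^ 2 with hX
  set Z := ∫⁻ x in outer n R, normWeight (b / 2 * σ) x * ‖u x‖ₑ ^ σ with hZdef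
  have hZt : Z ^ t ≤ (C : ℝ≥0∞) ^ θ * X ^ θ := by
    rw [← ENNReal.mul_rpow_of_nonneg _ _ hθ₀, ← hθt, ENNReal.rpow_mul]
    exact ENNReal.rpow_le_rpow hZ ht₀
  have hB : ENNReal.ofReal (R ^ (-κ)) * rho s u R ^ (1 - t) =
      (ENNReal.ofReal (R ^ (-(2 - b - 2 * s))) * rho s u R ^ μ) ^ (1 - θ) := by
    rw [ENNReal.mul_rpow_of_nonneg _ _ (by linarith), ← ENNReal.rpow_mul, ← hμt,
      ENNReal.ofReal_rpow_of_nonneg (by positivity) (by linarith), ← Real.rpow_mul hR.le, neg_mul]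
  calc ∫⁻ x in outer n R, normWeight c x * ‖u x‖ₑ ^ (p + 2)
      ≤ ENNReal.ofReal (2 ^ |c - b / 2 * σ * t|) * dyadicSum κ * ENNReal.ofReal (R ^ (-κ)) *
          (Z ^ t * rho s u R ^ (1 - t)) :=
        setLIntegral_outer_interpolation_le ht₀ ht₁ (by positivity) hpt hexp hR
          hug.locallyIntegrable.aestronglyMeasurable
    _ ≤ ENNReal.ofReal (2 ^ |c - b / 2 * σ * t|) * dyadicSum κ * ENNReal.ofReal (R ^ (-κ)) *
          ((C : ℝ≥0∞) ^ θ * X ^ θ * rho s u R ^ (1 - t)) := by gcongr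
    _ = K * (X ^ θ * (ENNReal.ofReal (R ^ (-κ)) * rho s u R ^ (1 - t))) := by rw [hK]; ring
    _ ≤ η * X + Cη * (ENNReal.ofReal (R ^ (-(2 - b - 2 * s))) * rho s u R ^ μ) := by
        rw [hB]
        have := hY X (ENNReal.ofReal (R ^ (-(2 - b - 2 * s))) * rho s u R ^ μ)
        rwa [ENNReal.coe_toNNReal hKtop] at this
    _ = _ := by
        rw [Real.rpow_neg hR.le, ENNReal.ofReal_inv_of_pos hRpos, div_eq_mul_inv, mul_assoc]

end DINLS

/-! ### The parameter conditions in terms of `s_c`, and the conclusion -/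

theorem lemma4p2 (n : ℕ) (b c p γ : ℝ) (hn : 3 ≤ n)
    (hb₁ : 2 - (n : ℝ) < b) (hb₂ : b < 2)
    (hc₁ : b - 2 < c) (hc₂ : c < n * b * p / 4)
    (hpc₁ : 2 * (2 - b) < DINLS.pCrit n c p)
    (hpc₂ : DINLS.pCrit n c p < (2 - b) * (p + 2))
    (hp : p < 4 / n) (hγ : -(n : ℝ) < γ) :
    (2 ≤ DINLS.sigmaZero n b c p γ →
      (∃ C : ℝ≥0, 0 < C ∧ ∀ u : DINLS.Rn n → ℂ,
        DINLS.MemWeightedLp γ (DINLS.sigmaZero n b c p γ) u →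
        ∀ R : ℝ, 0 < R →
          DINLS.ballMass (DINLS.sCrit n b c p) u R ≤
            C * DINLS.weightedNorm γ (DINLS.sigmaZero n b c p γ) u ^ 2) ∧
      (∀ u : DINLS.Rn n → ℂ,
        DINLS.MemWeightedLp γ (DINLS.sigmaZero n b c p γ) u →
        Tendsto (fun R : ℝ => DINLS.ballMass (DINLS.sCrit n b c p) u R) atTop (𝓝 0))) ∧
    (∀ η : ℝ≥0, 0 < η → ∃ Cη : ℝ≥0, 0 < Cη ∧
      ∀ (u : DINLS.Rn n → ℂ) (g : DINLS.Rn n → EuclideanSpace ℂ (Fin n)),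
        DINLS.MemHomogeneousSobolev (DINLS.sCrit n b c p) u →
        DINLS.MemWeightedSobolev b u g →
        ∀ R : ℝ, 0 < R →
          ∫⁻ x in {x : DINLS.Rn n | R ≤ ‖x‖}, ENNReal.ofReal (‖x‖ ^ c) * ‖u x‖ₑ ^ (p + 2) ≤
            η * DINLS.weightedNorm b 2 g ^ 2 +
              Cη / ENNReal.ofReal (R ^ (2 - b - 2 * DINLS.sCrit n b c p)) *
                DINLS.rho (DINLS.sCrit n b c p) u R ^ ((4 - n * p + 2 * p) / (4 - n * p))) := by
  have hn0 : 0 < n := by omega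
  have hnR : (0 : ℝ) < n := by exact_mod_cast hn0
  unfold DINLS.pCrit at hpc₁ hpc₂
  have hbc : 0 < 2 - b + c := by linarith
  have hp₀ : 0 < p := by
    have : 0 < (n : ℝ) * p := by linarith
    exact (pos_iff_pos_of_mul_pos this).mp hnR
  have hp₁ : n * p < 4 := by
    rw [lt_div_iff₀ hnR] at hp
    linarith
  have hsp : DINLS.sCrit n b c p * p = n * p / 2 - (2 - b + c) := by
    rw [DINLS.sCrit, sub_mul, div_mul_cancel₀ _ hp₀.ne']
    ring
  -- After multiplication by `p`, the lower bound on `np - 2c` is `s_c > 0` and the upper bound is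
  -- `2 s_c < 2 - b`.
  have hs₀ : 0 < DINLS.sCrit n b c p := by
    refine pos_of_mul_pos_left ?_ hp₀.le
    rw [hsp]
    linarith
  have hs₁ : 2 * DINLS.sCrit n b c p < 2 - b := by
    refine lt_of_mul_lt_mul_right ?_ hp₀.le
    rw [mul_assoc, hsp]
    linarith
  refine ⟨fun hσ => ?_, fun η hη => ?_⟩
  · have hγσ : (n + γ) / DINLS.sigmaZero n b c p γ = n / 2 - DINLS.sCrit n b c p := by
      have hnγ : (n : ℝ) + γ ≠ 0 := by linarith
      rw [DINLS.sigmaZero, DINLS.sCrit]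
      field_simp
      ring
    refine ⟨?_, fun u hu => DINLS.tendsto_ballMass_zero hn0 hs₀ hσ hγσ hu⟩
    obtain ⟨K, hK⟩ := DINLS.exists_ballMass_le hn0 hs₀ hσ hγσ
    -- The Hölder constant is only known to be nonnegative; adding 1 makes it positive.
    refine ⟨K + 1, by positivity, fun u hu R hR => (hK u hu.1 R hR).trans ?_⟩
    gcongr
    exact le_self_add
  · obtain ⟨Cη, hCη, h⟩ := DINLS.exists_outer_potential_le hn hb₁ hp₀ hp₁ hs₁ hsp hη
    refine ⟨Cη, hCη, fun u g _ hg R hR => ?_⟩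
    rw [DINLS.weightedNorm_sq, div_self two_ne_zero, ENNReal.rpow_one]
    simp only [ENNReal.rpow_two]
    exact h u g hg.1 R hR
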